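/- **Setting.** Let $\mathcal G=(V,E)$ be a connected simple undirected graph with $n\ge 2$ nodes and $m$ edges, $L=D-A$ its Laplacian, $B$ its (arbitrarily oriented) edge–node incidence matrix, $\Omega=(I+L)^{-1}$, and let $s\in[0,1]^V$ be the internal opinions. For $T\subseteq V$ let $s^T$ be $s$ with the entries in $T$ replaced by $0$ and $z^T=\Omega s^T$ the equilibrium opinions of the Friedkin–Johnsen model. Let $f(T)$ be either the resistance $(s^T)^\top z^T$ or the controversy $(z^T)^\top z^T$. Let $0\le k\le n$, let $T_{\rm opt}$ minimize $f$ among the $k$-element subsets of $V$, and let $0<\epsilon\le 1/2$. **Estimator.** An estimator is a randomized procedure which, given a symmetric diagonally dominant M-matrix $S\in\mathbb R^{n\times n}$ (SDDM: positive definite, nonpositive off the diagonal, nonnegative row sums), $b\in\mathbb R^n$ and $\delta>0$, returns a vector $y$. It has failure probability at most $\eta=\eta(n)\le 1$ if for each input $\|y-S^{-1}b\|_S\le\delta\|S^{-1}b\|_S$ holds with probability at least $1-\eta$, where $\|y\|_S=\sqrt{y^\top S y}$. It is nearly linear with constants $(A,a)$ if for $n\ge 2$ its expected number of steps on each input is at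 most $A\cdot{\rm nnz}(S)\,(\log n)^a$, with ${\rm nnz}(S)$ the number of nonzero entries of $S$. **Algorithm Greedy-AC.** Put $p=\lceil 24\log n/(\epsilon/12)^2\rceil$ and fix $$0<\delta_1\le\tfrac{\epsilon\sqrt{1-\epsilon/12}\,(n-1)}{32n^2(n+1)\sqrt{(1+\epsilon/12)(n+1)n}},\quad 0<\delta_2\le\tfrac{\epsilon\sqrt{1-\epsilon/12}}{32(n+1)\sqrt{(1+\epsilon/12)(n+1)n}},\quad 0<\delta_3\le\tfrac{\epsilon}{6\det(I+L)\sqrt{n(1+n)}} .$$ Start with $T=\emptyset$ and repeat $k$ times: draw fresh random matrices $P\in\mathbb R^{p\times n}$, $Q\in\mathbb R^{p\times m}$ with independent entries (uniform on $\pm1/\sqrt p$, or Gaussian $N(0,1/p)$); for each $r=1,\dots,p$ compute by calls of the estimator, with fresh independent randomness, $q\leftarrow(I+L,s,\delta_3)$, $h\leftarrow(I+L,q,\delta_3)$, the row $\tilde X_r\leftarrow(I+L,(QB)_r,\delta_1)$ and the row $\tilde Y_r\leftarrow(I+L,P_r,\delta_2)$ (so that the last $q,h$ are kept); for each node $i$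 put $\hat\Delta(i)=s_i\bigl(2q_i-(\|\tilde Xe_i\|^2+\|\tilde Ye_i\|^2)s_i\bigr)$ for resistance and $\hat\Delta(i)=s_i\bigl(2h_i-\|\tilde Ye_i\|^2s_i\bigr)$ for controversy; choose $i\in V\setminus T$ maximizing $\hat\Delta(i)$ (ties broken by an arbitrary fixed rule, which may depend on $T$), add $i$ to $T$ and set $s_i\leftarrow0$. Return $T$. **Theorem.** 1. If the estimator has failure probability at most $\eta$, then the set $T$ returned by Greedy-AC satisfies $|T|=k$ and $$f(\emptyset)-f(T)\ \ge\ \Bigl(1-\frac1e-\epsilon\Bigr)\bigl(f(\emptyset)-f(T_{\rm opt})\bigr)$$ with probability at least $\bigl(1-\frac1n\bigr)(1-\eta)^{(2p+2)k}$; that is, with probability $1-\frac1n$ up to the possible failures of the $(2p+2)k$ estimator calls whose results are used. 2. For all $A,a$ there are constants $C,c$, depending on nothing else, such that if the estimator is nearly linear with constants $(A,a)$ and $k\ge1$, then the expected running time of Greedy-AC, counted in unit-cost real arithmetic operations, comparisons, memory accesses and random draws, plus the steps of the estimator calls, and with $p,\delta_1,\delta_2,\delta_3$ given, is at most $C\,m\,k\,\epsilon^{-2}(\log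 n)^c$, i.e. $\tilde O(mk\epsilon^{-2})$. -/

import Mathlib

open MeasureTheory ProbabilityTheory
open scoped ENNReal NNReal Matrix

noncomputable section

namespace GreedyAC

/-! ### Conflict measures of the Friedkin–Johnsen model -/

/-- The two conflict measures. -/
inductive Objective where
  | resistance
  | controversy

/-- `I + L`, with `L` the graph Laplacian. -/
def shiftedLap {n : ℕ} (G : SimpleGraph (Fin n)) [DecidableRel G.Adj] :
    Matrix (Fin n) (Fin n) ℝ :=
  1 + G.lapMatrix ℝ

/-- Equilibrium expressed opinions `z = (I + L)⁻¹ s`. -/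
def equilibrium {n : ℕ} (G : SimpleGraph (Fin n)) [DecidableRel G.Adj] (s : Fin n → ℝ) :
    Fin n → ℝ :=
  (shiftedLap G)⁻¹ *ᵥ s

/-- The value of the measure at internal opinions `s`: resistance is `sᵀ z`, controversy `zᵀ z`. -/
def conflict {n : ℕ} (G : SimpleGraph (Fin n)) [DecidableRel G.Adj] (o : Objective)
    (s : Fin n → ℝ) : ℝ :=
  match o with
  | .resistance => s ⬝ᵥ equilibrium G s
  | .controversy => equilibrium G s ⬝ᵥ equilibrium G s

/-- `f(T)`: the measure after the internal opinions of the nodes of `T` have been set to `0`. -/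
def objective {n : ℕ} (G : SimpleGraph (Fin n)) [DecidableRel G.Adj] (o : Objective)
    (s : Fin n → ℝ) (T : Finset (Fin n)) : ℝ :=
  conflict G o (fun i => if i ∈ T then 0 else s i)

/-- `T` minimizes `f` among the sets of exactly `k` nodes. -/
def IsOptimal {n : ℕ} (f : Finset (Fin n) → ℝ) (k : ℕ) (T : Finset (Fin n)) : Prop :=
  T.card = k ∧ ∀ T' : Finset (Fin n), T'.card = k → f T ≤ f T'

/-- A listing of the edges of `G`, each exactly once and with an arbitrary orientation. -/
structure EdgeList {n : ℕ} (G : SimpleGraph (Fin n)) (m : ℕ) where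
  head : Fin m → Fin n
  tail : Fin m → Fin n
  adj : ∀ e, G.Adj (head e) (tail e)
  inj : Function.Injective fun e => s(head e, tail e)
  surj : ∀ i j, G.Adj i j → ∃ e, s(head e, tail e) = s(i, j)

/-! ### Step counting (real RAM with unit cost instructions) -/

/-- The result of a computation together with the number of steps it took. -/
structure Timed (α : Type) where
  val : α
  steps : ℕ

namespace Timed

instance : Monad Timed where
  pure x := ⟨x, 0⟩
  bind x f := ⟨(f x.val).val, x.steps + (f x.val).steps⟩

/-- `c` steps without a result. -/
def tick (c : ℕ) : Timed Unit := ⟨(), c⟩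

/-- One instruction: an arithmetic operation, comparison, memory access or random draw. -/
def op {α : Type} (x : α) : Timed α := ⟨x, 1⟩

/-- `for i = 0, …, N - 1` with a mutable state; one step of overhead per iteration. -/
def loop {σ : Type} (N : ℕ) (body : Fin N → σ → Timed σ) (init : σ) : Timed σ :=
  (List.finRange N).foldlM (fun st i => do tick 1; body i st) init

/-- Fill an array of length `N`: the cost of all entries, and one write for each. -/
def tabulate {α : Type} (N : ℕ) (f : Fin N → Timed α) : Timed (Fin N → α) :=
  ⟨fun i => (f i).val, ∑ i, ((f i).steps + 1)⟩

/-- Copy a vector. -/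
def store {N : ℕ} (v : Fin N → ℝ) : Timed (Fin N → ℝ) :=
  tabulate N fun i => op (v i)

end Timed

/-! ### Estimators for SDDM linear systems -/

/-- Symmetric, diagonally dominant M-matrices. -/
structure IsSDDM {n : ℕ} (S : Matrix (Fin n) (Fin n) ℝ) : Prop where
  posDef : S.PosDef
  offDiag : ∀ i j, i ≠ j → S i j ≤ 0
  rowSum : ∀ i, 0 ≤ ∑ j, S i j

/-- Number of nonzero entries. -/
def nnz {n : ℕ} (S : Matrix (Fin n) (Fin n) ℝ) : ℕ :=
  {x : Fin n × Fin n | S x.1 x.2 ≠ 0}.ncard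

/-- `‖y‖_S = √(yᵀ S y)`. -/
def energyNorm {n : ℕ} (S : Matrix (Fin n) (Fin n) ℝ) (y : Fin n → ℝ) : ℝ :=
  √(y ⬝ᵥ (S *ᵥ y))

universe u

/-- A randomized procedure that, given a matrix, a right-hand side, an error parameter and a
random seed, returns a vector after some number of steps. -/
structure Estimator where
  Seed : Type u
  [seedSpace : MeasurableSpace Seed]
  seedLaw : Measure Seed
  [seedProb : IsProbabilityMeasure seedLaw]
  run : {n : ℕ} → Matrix (Fin n) (Fin n) ℝ → (Fin n → ℝ) → ℝ → Seed → Timed (Fin n → ℝ)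
  measurable_val : ∀ {n : ℕ} (S : Matrix (Fin n) (Fin n) ℝ) (δ : ℝ),
    Measurable fun x : (Fin n → ℝ) × Seed => (run S x.1 δ x.2).val
  measurable_steps : ∀ {n : ℕ} (S : Matrix (Fin n) (Fin n) ℝ) (δ : ℝ),
    Measurable fun x : (Fin n → ℝ) × Seed => (run S x.1 δ x.2).steps

attribute [instance] Estimator.seedSpace Estimator.seedProb

namespace Estimator

/-- On every SDDM system of size `n` the estimator returns, with probability at least `1 - η n`, a
vector `y` with `‖y - S⁻¹ b‖_S ≤ δ ‖S⁻¹ b‖_S`. -/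
def Reliable (E : Estimator.{u}) (η : ℕ → ℝ) : Prop :=
  ∀ (n : ℕ) (S : Matrix (Fin n) (Fin n) ℝ) (b : Fin n → ℝ) (δ : ℝ), IsSDDM S → 0 < δ →
    1 - η n ≤ E.seedLaw.real
      {ω | energyNorm S ((E.run S b δ ω).val - S⁻¹ *ᵥ b) ≤ δ * energyNorm S (S⁻¹ *ᵥ b)}

/-- Expected running time `Õ(nnz)` on SDDM systems, with explicit constants. -/
def NearlyLinear (E : Estimator.{u}) (A : ℝ) (a : ℕ) : Prop :=
  ∀ (n : ℕ) (S : Matrix (Fin n) (Fin n) ℝ) (b : Fin n → ℝ) (δ : ℝ), 2 ≤ n → IsSDDM S → 0 < δ →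
    ∫⁻ ω, ((E.run S b δ ω).steps : ℝ≥0∞) ∂E.seedLaw ≤
      ENNReal.ofReal (A * nnz S * Real.log n ^ a)

end Estimator

/-! ### Random projections -/

/-- The two kinds of random projection matrices: random signs and Gaussian. -/
inductive Sketch where
  | sign
  | gaussian

/-- Law of one entry of a projection matrix with `p` rows: uniform on `±1/√p`, or `N(0, 1/p)`. -/
def Sketch.entryLaw (κ : Sketch) (p : ℕ) : Measure ℝ :=
  match κ with
  | .sign => (2⁻¹ : ℝ≥0∞) • Measure.dirac (1 / √(p : ℝ)) +
      (2⁻¹ : ℝ≥0∞) • Measure.dirac (-(1 / √(p : ℝ)))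
  | .gaussian => gaussianReal 0 (p : ℝ≥0)⁻¹

/-- Number of rows of the projection matrices. -/
def sketchDim (n : ℕ) (ε : ℝ) : ℕ :=
  ⌈24 * Real.log n / (ε / 12) ^ 2⌉₊

/-- Randomness of one call of `estimateDelta`: the entries of `P` and `Q`, and one seed for each of
the four estimator calls in each of the `p` iterations. -/
abbrev RoundTape (n m p : ℕ) (Seed : Type u) : Type u :=
  (Fin p → Fin n → ℝ) × (Fin p → Fin m → ℝ) × (Fin p → Fin 4 → Seed)

/-- All random entries and seeds of the `k` rounds are independent. -/
def tapeLaw (E : Estimator.{u}) (κ : Sketch) (n m p k : ℕ) :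
    Measure (Fin k → RoundTape n m p E.Seed) :=
  Measure.pi fun _ =>
    (Measure.pi fun _ => Measure.pi fun _ => κ.entryLaw p).prod
      ((Measure.pi fun _ => Measure.pi fun _ => κ.entryLaw p).prod
        (Measure.pi fun _ => Measure.pi fun _ => E.seedLaw))

/-! ### The algorithm -/

/-- Upper bound for the error parameter `δ₁`. -/
def delta₁Bound (n : ℕ) (ε : ℝ) : ℝ :=
  ε * √(1 - ε / 12) * (n - 1) /
    (32 * n ^ 2 * (n + 1) * √((1 + ε / 12) * (n + 1) * n))

/-- Upper bound for the error parameter `δ₂`. -/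
def delta₂Bound (n : ℕ) (ε : ℝ) : ℝ :=
  ε * √(1 - ε / 12) / (32 * (n + 1) * √((1 + ε / 12) * (n + 1) * n))

/-- Upper bound for the error parameter `δ₃`; `|I + L|` is the determinant. -/
def delta₃Bound {n : ℕ} (G : SimpleGraph (Fin n)) [DecidableRel G.Adj] (ε : ℝ) : ℝ :=
  ε / (6 * (shiftedLap G).det * √(n * (1 + n)))

/-- The error parameters are positive and below their bounds. -/
structure Precision {n : ℕ} (G : SimpleGraph (Fin n)) [DecidableRel G.Adj] (ε : ℝ) where
  δ₁ : ℝ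
  δ₂ : ℝ
  δ₃ : ℝ
  pos₁ : 0 < δ₁
  pos₂ : 0 < δ₂
  pos₃ : 0 < δ₃
  le₁ : δ₁ ≤ delta₁Bound n ε
  le₂ : δ₂ ≤ delta₂Bound n ε
  le₃ : δ₃ ≤ delta₃Bound G ε

section Algorithm

variable {n m : ℕ} {G : SimpleGraph (Fin n)}

/-- Sparse assembly of `I + L` from the edge list: `n` diagonal writes, then four entries are read,
changed and written back for each edge. -/
def assemble (edges : EdgeList G m) : Timed (Matrix (Fin n) (Fin n) ℝ) := do
  Timed.tick n
  Timed.loop m (fun e S => do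
    let i := edges.head e
    let j := edges.tail e
    Timed.tick 12
    pure (S + Matrix.single i i 1 + Matrix.single j j 1
      - Matrix.single i j 1 - Matrix.single j i 1)) 1

/-- One row of `Q B`, from the corresponding row `v` of `Q`: an edge with head `i` and tail `j` adds
its entry at `i` and subtracts it at `j`. -/
def sparseRow (edges : EdgeList G m) (v : Fin m → ℝ) : Timed (Fin n → ℝ) := do
  let zero ← Timed.tabulate n fun _ => Timed.op (0 : ℝ)
  Timed.loop m (fun e w => do
    let x ← Timed.op (v e)
    let a ← Timed.op (w (edges.head e))
    let a' ← Timed.op (a + x)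
    let w ← Timed.op (Function.update w (edges.head e) a')
    let b ← Timed.op (w (edges.tail e))
    let b' ← Timed.op (b - x)
    Timed.op (Function.update w (edges.tail e) b')) zero

/-- Squared norm of column `i` of a matrix with `p` rows. -/
def columnSq {p : ℕ} (X : Fin p → Fin n → ℝ) (i : Fin n) : Timed ℝ :=
  Timed.loop p (fun r acc => do
    let x ← Timed.op (X r i)
    let y ← Timed.op (x * x)
    Timed.op (acc + y)) 0

/-- Estimates of the marginal gains of all nodes at internal opinions `s`. -/
def estimateDelta [DecidableRel G.Adj] {ε : ℝ} (E : Estimator.{u}) (o : Objective)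
    (edges : EdgeList G m) (δ : Precision G ε) (p : ℕ) (s : Fin n → ℝ)
    (τ : RoundTape n m p E.Seed) : Timed (Fin n → ℝ) := do
  -- the scalars `δ₁`, `δ₂`, `δ₃`, `p`
  Timed.tick 4
  let S ← assemble edges
  let P ← Timed.tabulate p fun r => Timed.tabulate n fun i => Timed.op (τ.1 r i)
  let Q ← Timed.tabulate p fun r => Timed.tabulate m fun e => Timed.op (τ.2.1 r e)
  let QB ← Timed.tabulate p fun r => sparseRow edges (Q r)
  let (q, h, X, Y) ← Timed.loop p
    (fun r (st : (Fin n → ℝ) × (Fin n → ℝ) × (Fin p → Fin n → ℝ) × (Fin p → Fin n → ℝ)) => do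
      let q ← E.run S s δ.δ₃ (τ.2.2 r 0)
      let q ← Timed.store q
      let h ← E.run S q δ.δ₃ (τ.2.2 r 1)
      let h ← Timed.store h
      let x ← E.run S (QB r) δ.δ₁ (τ.2.2 r 2)
      let x ← Timed.store x
      let y ← E.run S (P r) δ.δ₂ (τ.2.2 r 3)
      let y ← Timed.store y
      pure (q, h, Function.update st.2.2.1 r x, Function.update st.2.2.2 r y))
    (0, 0, 0, 0)
  Timed.tabulate n fun i => do
    let x ← columnSq X i
    let y ← columnSq Y i
    -- memory accesses and arithmetic of the two formulas
    Timed.tick 16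
    let gainI := s i * (2 * q i - (x + y) * s i)
    let gainC := s i * (2 * h i - y * s i)
    match o with
    | .resistance => pure gainI
    | .controversy => pure gainC

/-- A node outside `T` with the largest value of `d`, by a linear scan; equal values are resolved by
the rule `tie`. -/
def argmaxOutside (tie : Finset (Fin n) → Fin n → Fin n → Bool) (T : Finset (Fin n))
    (d : Fin n → ℝ) : Timed (Option (Fin n)) :=
  Timed.loop n (fun i best => do
    -- membership in `T` is read from a bit array
    Timed.tick 1
    if i ∈ T then pure best
    else match best with
      | none => Timed.op (some i)
      | some j => do
        Timed.tick 5
        if d j < d i ∨ (d j = d i ∧ tie T j i = true) then pure (some i) else pure (some j)) none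

/-- Greedy-AC, run on the random tape `τ`. -/
def greedyAC [DecidableRel G.Adj] {ε : ℝ} (E : Estimator.{u}) (o : Objective)
    (tie : Finset (Fin n) → Fin n → Fin n → Bool) (edges : EdgeList G m) (δ : Precision G ε)
    (s : Fin n → ℝ) (k : ℕ) (τ : Fin k → RoundTape n m (sketchDim n ε) E.Seed) :
    Timed (Finset (Fin n)) := do
  -- initialization of the bit array for `T` and of the working copy of `s`
  Timed.tick (2 * n)
  let out ← Timed.loop k (fun t (st : Finset (Fin n) × (Fin n → ℝ)) => do
    let (T, s) := st
    let d ← estimateDelta E o edges δ (sketchDim n ε) s (τ t)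
    let best ← argmaxOutside tie T d
    match best with
    | none => pure (T, s)
    | some i => do
      let T ← Timed.op (insert i T)
      let s ← Timed.op (Function.update s i 0)
      pure (T, s)) (∅, s)
  pure out.1

end Algorithm

end GreedyAC

end

noncomputable section

namespace GreedyAC

universe u

/-! ### Step counting -/

namespace Timed

variable {α β σ : Type}

/-! Both measures are quadratic forms `sᵀ M s`, with `M = Ω` or `M = Ω²`. By the minimum principle
for `I + L`, `M` is entrywise nonnegative. Zeroing entry `i` lowers the form by `s_i (2 (M s)_i -
M_ii s_i)`, which is nonnegative and can only shrink when other entries are zeroed as well. So `f`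
is nonincreasing and supermodular. A choice whose gain is at least `1 - ε` times the best one
multiplies the gap to the optimum by at most `1 - (1 - ε) / k` (`greedy_progress`), and `k` such
choices leave at most `e^(ε - 1) ≤ 1/e + ε` of it (`greedy_factor_le`).

Such a choice is made when every gain is known up to `1 ± ε/2` (`abs_estimateDelta_sub_gain_le`). As
`M_ii s_i ≤ (M s)_i`, nothing cancels in the gain, and relative errors of `(M s)_i` and `M_ii`
suffice. For the former, `det (I + L) • Ω` is an adjugate with positive integer entries, so a `δ₃`
small against `1 / det (I + L)` turns an energy-norm error into an entrywise relative one. For the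
latter, `Ω_ii = ‖BΩe_i‖² + ‖Ωe_i‖²` and `(Ω²)_ii = ‖Ωe_i‖²`; random projections preserve these norms
(`sketch_tail`), and since `Ω_ii ≥ 1/(n+1)` the solver errors in the projected rows are relatively
small.

In one round the two projections fail with probability at most `1/n²` in total, and only `2p + 2`
solver calls influence the outcome. These bounds hold for every state reached, so Fubini multiplies
them over the rounds (`pow_le_measure_loop`), and `(1 - 1/n²)^k ≥ 1 - 1/n` for `k ≤ n`.

For the running time, everything outside the solver costs `O(p (n + m))` per round
deterministically, the `4p` calls have expected cost governed by `nnz (I + L) ≤ n + 2m`, and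
connectedness gives `n ≤ m + 1`. -/

@[simp] lemma val_pure (x : α) : (pure x : Timed α).val = x := rfl

@[simp] lemma steps_pure (x : α) : (pure x : Timed α).steps = 0 := rfl

@[simp] lemma val_bind (x : Timed α) (f : α → Timed β) : (x >>= f).val = (f x.val).val := rfl

@[simp] lemma steps_bind (x : Timed α) (f : α → Timed β) :
    (x >>= f).steps = x.steps + (f x.val).steps := rfl

@[simp] lemma steps_tick (c : ℕ) : (tick c).steps = c := rfl

@[simp] lemma val_op (x : α) : (op x).val = x := rfl

@[simp] lemma steps_op (x : α) : (op x).steps = 1 := rfl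

@[simp] lemma val_tabulate (N : ℕ) (f : Fin N → Timed α) :
    (tabulate N f).val = fun i => (f i).val := rfl

@[simp] lemma steps_tabulate (N : ℕ) (f : Fin N → Timed α) :
    (tabulate N f).steps = ∑ i, ((f i).steps + 1) := rfl

@[simp] lemma val_store {N : ℕ} (v : Fin N → ℝ) : (store v).val = v := rfl

@[simp] lemma steps_store {N : ℕ} (v : Fin N → ℝ) : (store v).steps = 2 * N := by
  simp [store, mul_comm]

lemma val_foldlM {ι : Type} (l : List ι) (f : σ → ι → Timed σ) (init : σ) :
    (l.foldlM f init).val = l.foldl (fun st i => (f st i).val) init := by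
  induction l generalizing init with
  | nil => rfl
  | cons x l ih => simp [List.foldlM_cons, ih]

lemma val_loop (N : ℕ) (body : Fin N → σ → Timed σ) (init : σ) :
    (loop N body init).val = (List.finRange N).foldl (fun st i => (body i st).val) init := by
  simp [loop, val_foldlM]

lemma loop_succ (N : ℕ) (body : Fin (N + 1) → σ → Timed σ) (init : σ) :
    loop (N + 1) body init =
      ((do tick 1; body 0 init) >>= fun st => loop N (fun i => body i.succ) st) := by
  simp only [loop, List.finRange_succ, List.foldlM_cons, List.foldlM_map]

lemma val_loop_succ (N : ℕ) (body : Fin (N + 1) → σ → Timed σ) (init : σ) :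
    (loop (N + 1) body init).val = (loop N (fun i => body i.succ) (body 0 init).val).val := by
  rw [loop_succ]; rfl

lemma steps_loop_succ (N : ℕ) (body : Fin (N + 1) → σ → Timed σ) (init : σ) :
    (loop (N + 1) body init).steps =
      (1 + (body 0 init).steps) + (loop N (fun i => body i.succ) (body 0 init).val).steps := by
  rw [loop_succ]; rfl

lemma steps_loop_zero (body : Fin 0 → σ → Timed σ) (init : σ) :
    (loop 0 body init).steps = 0 := rfl

/-- A loop whose iterations have a cost that does not depend on the state. -/
lemma steps_loop_eq (N : ℕ) (body : Fin N → σ → Timed σ) (c : Fin N → ℕ)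
    (h : ∀ i st, (body i st).steps = c i) (init : σ) :
    (loop N body init).steps = ∑ i, (1 + c i) := by
  induction N generalizing init with
  | zero => simp [steps_loop_zero]
  | succ N ih =>
    rw [steps_loop_succ, h, ih _ (fun i => c i.succ) (fun i st => h i.succ st), Fin.sum_univ_succ]

lemma steps_loop_le (N : ℕ) (body : Fin N → σ → Timed σ) (c : ℕ)
    (h : ∀ i st, (body i st).steps ≤ c) (init : σ) :
    (loop N body init).steps ≤ N * (1 + c) := by
  induction N generalizing init with
  | zero => simp [steps_loop_zero]
  | succ N ih =>
    rw [steps_loop_succ]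
    have h1 := ih (fun i => body i.succ) (fun i st => h i.succ st) (body 0 init).val
    have h2 := h 0 init
    rw [add_mul]
    omega

/-- Invariant of a loop. -/
lemma loop_induction (N : ℕ) (body : Fin N → σ → Timed σ) (init : σ) (M : ℕ → σ → Prop)
    (h0 : M 0 init) (h : ∀ (i : Fin N) st, M i st → M (i + 1) (body i st).val) :
    M N (loop N body init).val := by
  induction N generalizing init M with
  | zero => exact h0
  | succ N ih =>
    rw [val_loop_succ]
    refine ih _ _ (fun j => M (j + 1)) ?_ ?_
    · simpa using h 0 init h0
    · intro i st hi
      simpa using h i.succ st (by simpa using hi)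

end Timed

lemma foldl_add_finRange {M : Type*} [AddCommMonoid M] (N : ℕ) (f : Fin N → M) (x : M) :
    (List.finRange N).foldl (fun acc i => acc + f i) x = x + ∑ i, f i := by
  induction N generalizing x with
  | zero => simp
  | succ N ih =>
    rw [List.finRange_succ, List.foldl_cons, List.foldl_map, ih (fun i => f i.succ),
      Fin.sum_univ_succ, add_assoc]

/-- The value written at an index does not depend on the array, so neither order nor repetition of
the writes matters. -/
lemma foldl_update_apply {ι : Type*} [DecidableEq ι] {α : Type*} (l : List ι) (x g : ι → α)
    (r : ι) :
    l.foldl (fun g i => Function.update g i (x i)) g r = if r ∈ l then x r else g r := by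
  induction l generalizing g with
  | nil => simp
  | cons i l ih =>
    rw [List.foldl_cons, ih]
    by_cases h : r ∈ l
    · simp [h]
    · by_cases h' : r = i
      · subst h'; simp [h]
      · simp [h, h']

section Algorithm

variable {n m : ℕ} {G : SimpleGraph (Fin n)}

/-! ### Incidence matrix -/

/-- `B x`: differences of `x` along the edges. -/
def edgeDiff (edges : EdgeList G m) (x : Fin n → ℝ) : Fin m → ℝ :=
  fun e => x (edges.head e) - x (edges.tail e)

/-- `Bᵀ v`. -/
def edgeDiv (edges : EdgeList G m) (v : Fin m → ℝ) : Fin n → ℝ :=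
  ∑ e, (Pi.single (edges.head e) (v e) - Pi.single (edges.tail e) (v e))

/-- Adjointness of `B` and `Bᵀ`. It turns a solve with right-hand side `Bᵀ Q_r` into the projection
of `BΩe_j` by `Q_r`. -/
lemma edgeDiv_dotProduct (edges : EdgeList G m) (v : Fin m → ℝ) (x : Fin n → ℝ) :
    edgeDiv edges v ⬝ᵥ x = v ⬝ᵥ edgeDiff edges x := by
  simp only [edgeDiv, sum_dotProduct, sub_dotProduct, single_dotProduct]
  simp only [edgeDiff, dotProduct, mul_sub]

lemma measurable_edgeDiv (edges : EdgeList G m) : Measurable (edgeDiv edges) := by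
  unfold edgeDiv
  refine measurable_pi_iff.mpr fun i => ?_
  simp only [Finset.sum_apply, Pi.sub_apply, Pi.single_apply]
  refine Finset.measurable_sum _ fun e _ => Measurable.sub ?_ ?_ <;>
  · split_ifs
    · exact measurable_pi_apply e
    · exact measurable_const

lemma val_sparseRow (edges : EdgeList G m) (v : Fin m → ℝ) :
    (sparseRow edges v).val = edgeDiv edges v := by
  -- The second read sees the first write, so the identity needs no `i ≠ j`.
  have key : ∀ (w : Fin n → ℝ) (i j : Fin n) (x : ℝ),
      Function.update (Function.update w i (w i + x)) j (Function.update w i (w i + x) j - x) =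
        w + (Pi.single i x - Pi.single j x) := by
    intro w i j x
    ext k
    simp only [Function.update_apply, Pi.add_apply, Pi.sub_apply, Pi.single_apply]
    split_ifs <;> simp_all [sub_eq_add_neg]
  simp only [sparseRow, Timed.val_bind, Timed.val_loop, Timed.val_tabulate, Timed.val_op, key,
    foldl_add_finRange]
  ext k
  simp [edgeDiv]

lemma steps_sparseRow (edges : EdgeList G m) (v : Fin m → ℝ) :
    (sparseRow edges v).steps = 2 * n + 8 * m := by
  simp only [sparseRow, Timed.steps_bind]
  rw [Timed.steps_loop_eq m _ (fun _ => 7) (fun i st => rfl)]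
  simp [mul_comm]

/-- The Laplacian is the sum of the Laplacians of the edges. -/
lemma sum_edge_lap [DecidableRel G.Adj] (edges : EdgeList G m) :
    ∑ e, (Matrix.single (edges.head e) (edges.head e) (1 : ℝ) +
      Matrix.single (edges.tail e) (edges.tail e) 1 - Matrix.single (edges.head e) (edges.tail e) 1
      - Matrix.single (edges.tail e) (edges.head e) 1) = G.lapMatrix ℝ := by
  set M := ∑ e, (Matrix.single (edges.head e) (edges.head e) (1 : ℝ) +
      Matrix.single (edges.tail e) (edges.tail e) 1 - Matrix.single (edges.head e) (edges.tail e) 1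
      - Matrix.single (edges.tail e) (edges.head e) 1) with hM
  have hoff : ∀ i j, i ≠ j → M i j = G.lapMatrix ℝ i j := by
    intro i j hij
    have hL : G.lapMatrix ℝ i j = - if G.Adj i j then 1 else 0 := by
      simp [SimpleGraph.lapMatrix, SimpleGraph.degMatrix, Matrix.diagonal_apply_ne _ hij,
        SimpleGraph.adjMatrix_apply]
    -- Off the diagonal an edge contributes `-1` exactly at its two orderings; as edges are listed
    -- once, at most one term of the sum survives.
    have hterm : ∀ e, (Matrix.single (edges.head e) (edges.head e) (1 : ℝ) +
        Matrix.single (edges.tail e) (edges.tail e) 1 -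
        Matrix.single (edges.head e) (edges.tail e) 1
        - Matrix.single (edges.tail e) (edges.head e) 1 : Matrix (Fin n) (Fin n) ℝ) i j =
        - if s(edges.head e, edges.tail e) = s(i, j) then 1 else 0 := by
      intro e
      have hne : edges.head e ≠ edges.tail e := (edges.adj e).ne
      simp only [Matrix.sub_apply, Matrix.add_apply, Matrix.single_apply, Sym2.eq_iff]
      by_cases h1 : edges.head e = i <;> by_cases h2 : edges.tail e = j <;>
        by_cases h3 : edges.head e = j <;> by_cases h4 : edges.tail e = i <;> simp_all
    rw [hL, hM, Matrix.sum_apply, Finset.sum_congr rfl fun e _ => hterm e, Finset.sum_neg_distrib]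
    congr 1
    split_ifs with h
    · obtain ⟨e, he⟩ := edges.surj i j h
      rw [Finset.sum_eq_single e, if_pos he]
      · intro e' _ hne
        rw [if_neg]
        intro he'
        exact hne (edges.inj (he'.trans he.symm))
      · simp
    · refine Finset.sum_eq_zero fun e _ => if_neg fun he => h ?_
      have := edges.adj e
      rwa [← SimpleGraph.mem_edgeSet, he, SimpleGraph.mem_edgeSet] at this
  -- Both matrices have zero row sums, so the off-diagonal entries determine the diagonal.
  have hrow : ∀ i, ∑ j, M i j = 0 := by
    intro i
    simp only [hM, Matrix.sum_apply]
    rw [Finset.sum_comm]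
    refine Finset.sum_eq_zero fun e _ => ?_
    simp only [Matrix.sub_apply, Matrix.add_apply, Matrix.single_apply, Finset.sum_sub_distrib,
      Finset.sum_add_distrib, ite_and]
    by_cases h1 : edges.head e = i <;> by_cases h2 : edges.tail e = i <;> simp [h1, h2]
  have hrow' : ∀ i, ∑ j, G.lapMatrix ℝ i j = 0 := by
    intro i
    have := congrFun (SimpleGraph.lapMatrix_mulVec_const_eq_zero (R := ℝ) (G := G)) i
    simpa [Matrix.mulVec, dotProduct] using this
  ext i j
  by_cases hij : i = j
  · subst hij
    have h1 := hrow i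
    have h2 := hrow' i
    rw [← Finset.add_sum_erase _ _ (Finset.mem_univ i)] at h1 h2
    have h3 : ∑ j ∈ Finset.univ.erase i, M i j = ∑ j ∈ Finset.univ.erase i, G.lapMatrix ℝ i j :=
      Finset.sum_congr rfl fun j hj => hoff i j (Finset.ne_of_mem_erase hj).symm
    linarith
  · exact hoff i j hij

lemma val_assemble [DecidableRel G.Adj] (edges : EdgeList G m) :
    (assemble edges).val = shiftedLap G := by
  -- Regrouping makes the loop an accumulation of summands independent of the state.
  have key : ∀ (S A B C D : Matrix (Fin n) (Fin n) ℝ), S + A + B - C - D = S + (A + B - C - D) := by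
    intros; abel
  simp only [assemble, Timed.val_bind, Timed.val_loop, Timed.val_pure, key, foldl_add_finRange,
    sum_edge_lap, shiftedLap]

lemma steps_assemble (edges : EdgeList G m) : (assemble edges).steps = n + 13 * m := by
  simp only [assemble, Timed.steps_bind]
  rw [Timed.steps_loop_eq m _ (fun _ => 12) (fun i st => rfl)]
  simp [mul_comm]

lemma val_columnSq {p : ℕ} (X : Fin p → Fin n → ℝ) (i : Fin n) :
    (columnSq X i).val = ∑ r, X r i ^ 2 := by
  simp only [columnSq, Timed.val_loop, Timed.val_bind, Timed.val_op, foldl_add_finRange, zero_add,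
    pow_two]

lemma steps_columnSq {p : ℕ} (X : Fin p → Fin n → ℝ) (i : Fin n) :
    (columnSq X i).steps = 4 * p := by
  simp only [columnSq]
  rw [Timed.steps_loop_eq p _ (fun _ => 3) (fun i st => rfl)]
  simp [mul_comm]

lemma steps_argmaxOutside_le (tie : Finset (Fin n) → Fin n → Fin n → Bool) (T : Finset (Fin n))
    (d : Fin n → ℝ) : (argmaxOutside tie T d).steps ≤ 7 * n := by
  rw [argmaxOutside, mul_comm]
  refine Timed.steps_loop_le n _ 6 (fun i st => ?_) none
  rw [Timed.steps_bind, Timed.steps_tick]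
  split_ifs
  · simp
  · cases st with
    | none => simp
    | some j =>
      simp only [Timed.steps_bind, Timed.steps_tick]
      split_ifs <;> simp

/-- The linear scan finds a maximizer outside `T` if there is a node outside `T`. -/
lemma argmaxOutside_spec (tie : Finset (Fin n) → Fin n → Fin n → Bool) (T : Finset (Fin n))
    (d : Fin n → ℝ) (hT : T.card < n) :
    ∃ i, (argmaxOutside tie T d).val = some i ∧ i ∉ T ∧ ∀ j, j ∉ T → d j ≤ d i := by
  have key := Timed.loop_induction n (σ := Option (Fin n)) (fun i best => do
    Timed.tick 1
    if i ∈ T then pure best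
    else match best with
      | none => Timed.op (some i)
      | some j => do
        Timed.tick 5
        if d j < d i ∨ (d j = d i ∧ tie T j i = true) then pure (some i) else pure (some j)) none
    -- The clause for `none` rules out an empty result at the end: it would force `T` to contain
    -- every node.
    (fun N best => (best = none → ∀ j : Fin n, (j : ℕ) < N → j ∈ T) ∧
      ∀ i, best = some i → i ∉ T ∧ ∀ j : Fin n, (j : ℕ) < N → j ∉ T → d j ≤ d i)
    ⟨fun _ j hj => absurd hj (Nat.not_lt_zero _), fun i hi => by simp at hi⟩ ?_
  · obtain ⟨h1, h2⟩ := key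
    change ((argmaxOutside tie T d).val = none → _) at h1
    change ∀ i, (argmaxOutside tie T d).val = some i → _ at h2
    cases hv : (argmaxOutside tie T d).val with
    | none =>
      exfalso
      have : T = Finset.univ := Finset.eq_univ_iff_forall.mpr fun j => h1 hv j j.2
      rw [this, Finset.card_univ, Fintype.card_fin] at hT
      exact lt_irrefl _ hT
    | some i => exact ⟨i, rfl, (h2 i hv).1, fun j hj => (h2 i hv).2 j j.2 hj⟩
  · rintro i st ⟨h1, h2⟩
    have split : ∀ j : Fin n, (j : ℕ) < (i : ℕ) + 1 → (j : ℕ) < i ∨ j = i := by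
      intro j hj
      rcases Nat.lt_succ_iff_lt_or_eq.mp hj with h | h
      · exact Or.inl h
      · exact Or.inr (Fin.ext h)
    rw [Timed.val_bind]
    by_cases hi : i ∈ T
    · simp only [hi, if_true, Timed.val_pure]
      refine ⟨fun hs j hj => ?_, fun l hl => ⟨(h2 l hl).1, fun j hj hjT => ?_⟩⟩
      · rcases split j hj with h | h
        · exact h1 hs j h
        · exact h ▸ hi
      · rcases split j hj with h | h
        · exact (h2 l hl).2 j h hjT
        · exact absurd (h ▸ hi) hjT
    · simp only [hi, if_false]
      cases st with
      | none =>
        simp only [Timed.val_op]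
        refine ⟨by simp, fun l hl => ?_⟩
        obtain rfl : i = l := by simpa using hl
        refine ⟨hi, fun j hj hjT => ?_⟩
        rcases split j hj with h | h
        · exact absurd (h1 rfl j h) hjT
        · exact h ▸ le_rfl
      | some b =>
        obtain ⟨hb, hb'⟩ := h2 b rfl
        simp only [Timed.val_bind]
        split_ifs with hc
        · refine ⟨by simp, fun l hl => ?_⟩
          obtain rfl : i = l := by simpa using hl
          refine ⟨hi, fun j hj hjT => ?_⟩
          have hbi : d b ≤ d i := by
            rcases hc with hc | hc
            · exact hc.le
            · exact hc.1.le
          rcases split j hj with h | h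
          · exact (hb' j h hjT).trans hbi
          · exact h ▸ le_rfl
        · refine ⟨by simp, fun l hl => ?_⟩
          obtain rfl : b = l := by simpa using hl
          refine ⟨hb, fun j hj hjT => ?_⟩
          rcases split j hj with h | h
          · exact hb' j h hjT
          · rw [h]
            push Not at hc
            exact hc.1

/-! ### Values and cost of one round -/

section Round

variable [DecidableRel G.Adj] {ε : ℝ} (E : Estimator.{u}) (o : Objective)
    (edges : EdgeList G m) (δ : Precision G ε) {p : ℕ} (s : Fin n → ℝ)
    (τ : RoundTape n m p E.Seed)

/-- Estimate of `(I + L)⁻¹ s` in iteration `r`. -/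
def solveQ (r : Fin p) : Timed (Fin n → ℝ) :=
  E.run (shiftedLap G) s δ.δ₃ (τ.2.2 r 0)

/-- Estimate of `(I + L)⁻² s` in iteration `r`. -/
def solveH (r : Fin p) : Timed (Fin n → ℝ) :=
  E.run (shiftedLap G) (solveQ E δ s τ r).val δ.δ₃ (τ.2.2 r 1)

/-- Row `r` of `X̃`. -/
def solveX (r : Fin p) : Timed (Fin n → ℝ) :=
  E.run (shiftedLap G) (edgeDiv edges (τ.2.1 r)) δ.δ₁ (τ.2.2 r 2)

/-- Row `r` of `Ỹ`. -/
def solveY (r : Fin p) : Timed (Fin n → ℝ) :=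
  E.run (shiftedLap G) (τ.1 r) δ.δ₂ (τ.2.2 r 3)

/-- The formula for the estimated gain. -/
def gainFormula (o : Objective) (s q h x y : ℝ) : ℝ :=
  match o with
  | .resistance => s * (2 * q - (x + y) * s)
  | .controversy => s * (2 * h - y * s)

/-- One iteration of the loop of `estimateDelta`. -/
def solveBody (r : Fin p)
    (st : (Fin n → ℝ) × (Fin n → ℝ) × (Fin p → Fin n → ℝ) × (Fin p → Fin n → ℝ)) :
    Timed ((Fin n → ℝ) × (Fin n → ℝ) × (Fin p → Fin n → ℝ) × (Fin p → Fin n → ℝ)) := do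
  let q ← E.run (shiftedLap G) s δ.δ₃ (τ.2.2 r 0)
  let q ← Timed.store q
  let h ← E.run (shiftedLap G) q δ.δ₃ (τ.2.2 r 1)
  let h ← Timed.store h
  let x ← E.run (shiftedLap G) (edgeDiv edges (τ.2.1 r)) δ.δ₁ (τ.2.2 r 2)
  let x ← Timed.store x
  let y ← E.run (shiftedLap G) (τ.1 r) δ.δ₂ (τ.2.2 r 3)
  let y ← Timed.store y
  pure (q, h, Function.update st.2.2.1 r x, Function.update st.2.2.2 r y)

lemma val_solveBody (r : Fin p)
    (st : (Fin n → ℝ) × (Fin n → ℝ) × (Fin p → Fin n → ℝ) × (Fin p → Fin n → ℝ)) :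
    (solveBody E edges δ s τ r st).val =
      ((solveQ E δ s τ r).val, (solveH E δ s τ r).val,
        Function.update st.2.2.1 r (solveX E edges δ τ r).val,
        Function.update st.2.2.2 r (solveY E δ τ r).val) := rfl

lemma steps_solveBody (r : Fin p)
    (st : (Fin n → ℝ) × (Fin n → ℝ) × (Fin p → Fin n → ℝ) × (Fin p → Fin n → ℝ)) :
    (solveBody E edges δ s τ r st).steps =
      (solveQ E δ s τ r).steps + (solveH E δ s τ r).steps + (solveX E edges δ τ r).steps +
        (solveY E δ τ r).steps + 8 * n := by
  simp only [solveBody, solveQ, solveH, solveX, solveY, Timed.steps_bind, Timed.val_store,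
    Timed.steps_store, Timed.steps_pure]
  ring

/-- `q` and `h` are overwritten in each iteration, so those of the last index `p - 1` remain, while
each row of `X̃` and `Ỹ` is written once. -/
lemma val_loop_solveBody (hp : 0 < p) :
    (Timed.loop p (solveBody E edges δ s τ) (0, 0, 0, 0)).val =
      ((solveQ E δ s τ ⟨p - 1, by omega⟩).val, (solveH E δ s τ ⟨p - 1, by omega⟩).val,
        fun r => (solveX E edges δ τ r).val, fun r => (solveY E δ τ r).val) := by
  have h3 : ∀ (l : List (Fin p))
      (st : (Fin n → ℝ) × (Fin n → ℝ) × (Fin p → Fin n → ℝ) × (Fin p → Fin n → ℝ)),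
      (l.foldl (fun st r => (solveBody E edges δ s τ r st).val) st).2.2 =
        (l.foldl (fun g r => Function.update g r (solveX E edges δ τ r).val) st.2.2.1,
          l.foldl (fun g r => Function.update g r (solveY E δ τ r).val) st.2.2.2) := by
    intro l
    induction l with
    | nil => intro st; rfl
    | cons r l ih => intro st; rw [List.foldl_cons, ih]; rfl
  have hX : ∀ (x g : Fin p → Fin n → ℝ),
      (List.finRange p).foldl (fun g r => Function.update g r (x r)) g = x := by
    intro x g
    funext r
    rw [foldl_update_apply, if_pos (List.mem_finRange r)]
  have h4 := h3 (List.finRange p) (0, 0, 0, 0)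
  rw [hX, hX] at h4
  rw [Timed.val_loop]
  obtain ⟨p, rfl⟩ : ∃ p', p = p' + 1 := ⟨p - 1, by omega⟩
  have h5 : ∀ z : (Fin n → ℝ) × (Fin n → ℝ) × (Fin (p + 1) → Fin n → ℝ) ×
      (Fin (p + 1) → Fin n → ℝ), z = (z.1, z.2.1, z.2.2) := fun z => rfl
  rw [h5 (List.foldl _ _ _), h4, List.finRange_succ_last, List.foldl_append, List.foldl_cons,
    List.foldl_nil, val_solveBody]
  rfl

lemma val_estimateDelta (hp : 0 < p) (i : Fin n) :
    (estimateDelta E o edges δ p s τ).val i =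
      gainFormula o (s i) ((solveQ E δ s τ ⟨p - 1, by omega⟩).val i)
        ((solveH E δ s τ ⟨p - 1, by omega⟩).val i)
        (∑ r, (solveX E edges δ τ r).val i ^ 2) (∑ r, (solveY E δ τ r).val i ^ 2) := by
  have hl := val_loop_solveBody E edges δ s τ hp
  unfold solveBody at hl
  simp only [estimateDelta, Timed.val_bind, Timed.val_tabulate, Timed.val_op, val_assemble,
    val_sparseRow]
  rw [hl]
  cases o <;> simp only [val_columnSq, gainFormula, Timed.val_pure]

/-- Only the solver calls have a data-dependent cost; this separates it from a deterministic `O(p (n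
+ m))`. -/
lemma steps_estimateDelta :
    (estimateDelta E o edges δ p s τ).steps =
      (4 + (n + 13 * m) + p * (2 * n + 1) + p * (2 * m + 1) + p * (2 * n + 8 * m + 1) +
        p * (1 + 8 * n) + n * (8 * p + 17)) +
      ∑ r, ((solveQ E δ s τ r).steps + (solveH E δ s τ r).steps + (solveX E edges δ τ r).steps +
        (solveY E δ τ r).steps) := by
  have hl : (Timed.loop p (solveBody E edges δ s τ) (0, 0, 0, 0)).steps = _ :=
    Timed.steps_loop_eq p _ _ (fun r st => steps_solveBody E edges δ s τ r st) (0, 0, 0, 0)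
  unfold solveBody at hl
  simp only [estimateDelta, Timed.val_tabulate, Timed.val_op, val_assemble,
    val_sparseRow, Timed.steps_bind, Timed.steps_tick, Timed.steps_tabulate, Timed.steps_op,
    steps_assemble, steps_sparseRow]
  rw [hl]
  cases o <;>
  · simp only [steps_columnSq, Timed.steps_pure, Finset.sum_add_distrib, Finset.sum_const,
      Finset.card_univ, Fintype.card_fin, smul_eq_mul]
    ring

end Round

end Algorithm

/-! ### The matrix `Ω = (I + L)⁻¹` -/

section Omega

variable {n m : ℕ} {G : SimpleGraph (Fin n)} [DecidableRel G.Adj]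

lemma dotProduct_lap_mulVec (edges : EdgeList G m) (x y : Fin n → ℝ) :
    x ⬝ᵥ (G.lapMatrix ℝ *ᵥ y) = edgeDiff edges x ⬝ᵥ edgeDiff edges y := by
  rw [← sum_edge_lap edges, Matrix.sum_mulVec, dotProduct_sum]
  simp only [Matrix.sub_mulVec, Matrix.add_mulVec, dotProduct_sub, dotProduct_add,
    Matrix.single_mulVec, one_mul]
  have : ∀ (i : Fin n) (c : ℝ), x ⬝ᵥ Function.update 0 i c = x i * c := fun i c =>
    dotProduct_single x c i
  simp only [this]
  simp only [dotProduct, edgeDiff]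
  exact Finset.sum_congr rfl fun e _ => by ring

lemma dotProduct_shiftedLap_mulVec (x y : Fin n → ℝ) :
    x ⬝ᵥ (shiftedLap G *ᵥ y) = x ⬝ᵥ y + x ⬝ᵥ (G.lapMatrix ℝ *ᵥ y) := by
  rw [shiftedLap, Matrix.add_mulVec, Matrix.one_mulVec, dotProduct_add]

lemma dotProduct_lap_self (x : Fin n → ℝ) :
    x ⬝ᵥ (G.lapMatrix ℝ *ᵥ x) = (∑ i, ∑ j, if G.Adj i j then (x i - x j) ^ 2 else 0) / 2 := by
  rw [← SimpleGraph.lapMatrix_toLinearMap₂', Matrix.toLinearMap₂'_apply']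

lemma dotProduct_lap_self_nonneg (x : Fin n → ℝ) : 0 ≤ x ⬝ᵥ (G.lapMatrix ℝ *ᵥ x) := by
  rw [dotProduct_lap_self]
  refine div_nonneg (Finset.sum_nonneg fun i _ => Finset.sum_nonneg fun j _ => ?_) two_pos.le
  split_ifs
  · exact sq_nonneg _
  · exact le_rfl

/-- Extending the sum over adjacent pairs to all pairs replaces `L` by the Laplacian `nI - J` of the
complete graph (`J` the all-ones matrix), which is at most `nI`. -/
lemma dotProduct_lap_self_le (x : Fin n → ℝ) :
    x ⬝ᵥ (G.lapMatrix ℝ *ᵥ x) ≤ n * (x ⬝ᵥ x) := by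
  rw [dotProduct_lap_self]
  have h1 : (∑ i, ∑ j, if G.Adj i j then (x i - x j) ^ 2 else 0) ≤
      ∑ i, ∑ j, (x i - x j) ^ 2 := by
    refine Finset.sum_le_sum fun i _ => Finset.sum_le_sum fun j _ => ?_
    split_ifs
    · exact le_rfl
    · exact sq_nonneg _
  have h2 : ∑ i, ∑ j, (x i - x j) ^ 2 = 2 * (n * (x ⬝ᵥ x)) - 2 * (∑ i, x i) ^ 2 := by
    have : ∀ i j, (x i - x j) ^ 2 = x i * x i + x j * x j - 2 * (x i * x j) := by
      intros; ring
    simp only [this, Finset.sum_sub_distrib, Finset.sum_add_distrib, Finset.sum_const,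
      Finset.card_univ, Fintype.card_fin, ← Finset.mul_sum, ← Finset.sum_mul, dotProduct,
      nsmul_eq_mul]
    ring
  nlinarith [sq_nonneg (∑ i, x i)]

lemma dotProduct_self_le_energy (x : Fin n → ℝ) : x ⬝ᵥ x ≤ x ⬝ᵥ (shiftedLap G *ᵥ x) := by
  rw [dotProduct_shiftedLap_mulVec]
  linarith [dotProduct_lap_self_nonneg (G := G) x]

lemma energy_le (x : Fin n → ℝ) : x ⬝ᵥ (shiftedLap G *ᵥ x) ≤ (n + 1) * (x ⬝ᵥ x) := by
  rw [dotProduct_shiftedLap_mulVec]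
  linarith [dotProduct_lap_self_le (G := G) x]

lemma dotProduct_self_nonneg' (x : Fin n → ℝ) : 0 ≤ x ⬝ᵥ x :=
  Finset.sum_nonneg fun i _ => mul_self_nonneg (x i)

lemma sq_energyNorm (x : Fin n → ℝ) :
    energyNorm (shiftedLap G) x ^ 2 = x ⬝ᵥ (shiftedLap G *ᵥ x) :=
  Real.sq_sqrt ((dotProduct_self_nonneg' x).trans (dotProduct_self_le_energy x))

lemma energyNorm_nonneg (S : Matrix (Fin n) (Fin n) ℝ) (x : Fin n → ℝ) : 0 ≤ energyNorm S x :=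
  Real.sqrt_nonneg _

/-- Since `I ≼ I + L`, the energy norm dominates the Euclidean norm and hence every coordinate. -/
lemma abs_apply_le_energyNorm (x : Fin n → ℝ) (i : Fin n) :
    |x i| ≤ energyNorm (shiftedLap G) x := by
  refine abs_le_of_sq_le_sq ?_ (energyNorm_nonneg _ _)
  rw [sq_energyNorm]
  refine le_trans ?_ (dotProduct_self_le_energy x)
  rw [pow_two]
  exact Finset.single_le_sum (f := fun i => x i * x i) (fun j _ => mul_self_nonneg (x j))
    (Finset.mem_univ i)

variable (G) in
lemma posDef_shiftedLap : (shiftedLap G).PosDef :=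
  Matrix.PosDef.one.add_posSemidef (G.posSemidef_lapMatrix ℝ)

variable (G) in
lemma sum_shiftedLap (i : Fin n) : ∑ j, shiftedLap G i j = 1 := by
  have h := congrFun (SimpleGraph.lapMatrix_mulVec_const_eq_zero (R := ℝ) (G := G)) i
  simp only [Matrix.mulVec, dotProduct, mul_one, Pi.zero_apply] at h
  simp [shiftedLap, Matrix.add_apply, Finset.sum_add_distrib, Matrix.one_apply, h]

lemma shiftedLap_of_ne {i j : Fin n} (h : i ≠ j) :
    shiftedLap G i j = - if G.Adj i j then 1 else 0 := by
  simp [shiftedLap, SimpleGraph.lapMatrix, SimpleGraph.degMatrix, Matrix.diagonal_apply_ne _ h,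
    SimpleGraph.adjMatrix_apply, Matrix.one_apply_ne h]

lemma shiftedLap_nonpos_of_ne {i j : Fin n} (h : i ≠ j) : shiftedLap G i j ≤ 0 := by
  rw [shiftedLap_of_ne h]
  split_ifs <;> simp

lemma shiftedLap_self_le (i : Fin n) : shiftedLap G i i ≤ n + 1 := by
  have h := energy_le (G := G) (Pi.single i 1)
  simpa using h

variable (G) in
lemma isSDDM_shiftedLap : IsSDDM (shiftedLap G) where
  posDef := posDef_shiftedLap G
  offDiag _ _ h := shiftedLap_nonpos_of_ne h
  rowSum i := by rw [sum_shiftedLap]; exact zero_le_one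

variable (G) in
lemma det_shiftedLap_pos : 0 < (shiftedLap G).det := (posDef_shiftedLap G).det_pos

variable (G) in
lemma isUnit_det_shiftedLap : IsUnit (shiftedLap G).det :=
  isUnit_iff_ne_zero.mpr (det_shiftedLap_pos G).ne'

variable (G) in
/-- The column of `(I + L)⁻¹` at `i`. -/
def omegaCol (i : Fin n) : Fin n → ℝ := fun j => (shiftedLap G)⁻¹ j i

variable (G) in
lemma omega_symm (i j : Fin n) : (shiftedLap G)⁻¹ i j = (shiftedLap G)⁻¹ j i := by
  have h := (posDef_shiftedLap G).inv.isHermitian.apply i j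
  simpa using h.symm

lemma shiftedLap_mulVec_equilibrium (b : Fin n → ℝ) : shiftedLap G *ᵥ equilibrium G b = b := by
  rw [equilibrium, Matrix.mulVec_mulVec, Matrix.mul_nonsing_inv _ (isUnit_det_shiftedLap G),
    Matrix.one_mulVec]

lemma omegaCol_eq (i : Fin n) : omegaCol G i = equilibrium G (Pi.single i 1) := by
  rw [equilibrium, Matrix.mulVec_single_one]
  rfl

lemma shiftedLap_mulVec_omegaCol (i : Fin n) :
    shiftedLap G *ᵥ omegaCol G i = Pi.single i 1 := by
  rw [omegaCol_eq, shiftedLap_mulVec_equilibrium]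

/-- By symmetry of `Ω`. A solve with right-hand side `P_r` thus produces the projections of all
columns of `Ω` by `P_r` at once. -/
lemma equilibrium_apply (b : Fin n → ℝ) (i : Fin n) :
    equilibrium G b i = b ⬝ᵥ omegaCol G i := by
  simp only [equilibrium, Matrix.mulVec, dotProduct, omegaCol]
  exact Finset.sum_congr rfl fun j _ => by rw [omega_symm G i j, mul_comm]

/-- The minimum principle: `(I + L) x ≥ 0` implies `x ≥ 0`. -/
lemma nonneg_of_shiftedLap_mulVec_nonneg {x : Fin n → ℝ}
    (h : ∀ i, 0 ≤ (shiftedLap G *ᵥ x) i) (i : Fin n) : 0 ≤ x i := by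
  -- At a minimizer `k`, nonpositive off-diagonal entries and row sum `1` give `((I + L) x)_k ≤
  -- x_k`.
  obtain ⟨k, -, hk⟩ := Finset.exists_min_image Finset.univ x ⟨i, Finset.mem_univ i⟩
  refine le_trans ?_ (hk i (Finset.mem_univ i))
  refine (h k).trans ?_
  calc (shiftedLap G *ᵥ x) k = ∑ j, shiftedLap G k j * x j := rfl
    _ ≤ ∑ j, shiftedLap G k j * x k := by
        refine Finset.sum_le_sum fun j _ => ?_
        by_cases hjk : k = j
        · rw [hjk]
        · exact mul_le_mul_of_nonpos_left (hk j (Finset.mem_univ j)) (shiftedLap_nonpos_of_ne hjk)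
    _ = x k := by rw [← Finset.sum_mul, sum_shiftedLap, one_mul]

lemma equilibrium_nonneg {b : Fin n → ℝ} (hb : ∀ i, 0 ≤ b i) (i : Fin n) :
    0 ≤ equilibrium G b i :=
  nonneg_of_shiftedLap_mulVec_nonneg
    (fun j => by rw [shiftedLap_mulVec_equilibrium]; exact hb j) i

variable (G) in
lemma omega_nonneg (i j : Fin n) : 0 ≤ (shiftedLap G)⁻¹ i j := by
  have h : 0 ≤ omegaCol G j i := by
    rw [omegaCol_eq]
    exact equilibrium_nonneg (fun k => by simp [Pi.single_apply]; split_ifs <;> simp) i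
  exact h

variable (G) in
lemma sum_omega (i : Fin n) : ∑ j, (shiftedLap G)⁻¹ i j = 1 := by
  have h1 : shiftedLap G *ᵥ (fun _ => (1 : ℝ)) = fun _ => 1 := by
    funext i
    simpa [Matrix.mulVec, dotProduct] using sum_shiftedLap G i
  have h2 : (shiftedLap G)⁻¹ *ᵥ (fun _ => (1 : ℝ)) = fun _ => 1 := by
    conv_lhs => rw [← h1]
    rw [Matrix.mulVec_mulVec, Matrix.nonsing_inv_mul _ (isUnit_det_shiftedLap G),
      Matrix.one_mulVec]
  simpa [Matrix.mulVec, dotProduct] using congrFun h2 i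

variable (G) in
lemma omega_le_one (i j : Fin n) : (shiftedLap G)⁻¹ i j ≤ 1 := by
  rw [← sum_omega G i]
  exact Finset.single_le_sum (f := fun j => (shiftedLap G)⁻¹ i j) (fun j _ => omega_nonneg G i j)
    (Finset.mem_univ j)

/-- Strong minimum principle: where a column of `Ω` vanishes, its row equation forces it to vanish
at all neighbours. Connectedness then makes the whole column zero, although `I + L` maps it to a
unit vector. -/
lemma omega_pos (hG : G.Connected) (i j : Fin n) : 0 < (shiftedLap G)⁻¹ i j := by
  by_contra hcon
  have h0 : omegaCol G j i = 0 := le_antisymm (not_lt.mp hcon) (omega_nonneg G i j)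
  have hnn : ∀ k, 0 ≤ omegaCol G j k := fun k => omega_nonneg G k j
  have hS := shiftedLap_mulVec_omegaCol (G := G) j
  have step : ∀ k l, G.Adj k l → omegaCol G j k = 0 → omegaCol G j l = 0 := by
    intro k l hkl hk
    have h1 : (0 : ℝ) ≤ (shiftedLap G *ᵥ omegaCol G j) k := by
      rw [hS, Pi.single_apply]; split_ifs <;> simp
    have h2 : (shiftedLap G *ᵥ omegaCol G j) k ≤ shiftedLap G k l * omegaCol G j l := by
      change ∑ a, shiftedLap G k a * omegaCol G j a ≤ _
      rw [← Finset.add_sum_erase _ _ (Finset.mem_univ l)]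
      refine add_le_of_nonpos_right (Finset.sum_nonpos fun a _ => ?_)
      by_cases hak : k = a
      · rw [← hak, hk, mul_zero]
      · exact mul_nonpos_of_nonpos_of_nonneg (shiftedLap_nonpos_of_ne hak) (hnn a)
    rw [shiftedLap_of_ne hkl.ne, if_pos hkl] at h2
    linarith [hnn l]
  have hall : ∀ k, omegaCol G j k = 0 := by
    intro k
    obtain ⟨w⟩ := hG.preconnected i k
    induction w with
    | nil => exact h0
    | cons h w ih => exact ih (not_lt.mpr (le_of_eq (step _ _ h h0))) (step _ _ h h0)
  have : omegaCol G j = 0 := funext hall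
  rw [this, Matrix.mulVec_zero] at hS
  simpa using congrFun hS j

/-- Entries of the adjugate of `I + L` are positive integers. -/
lemma one_le_det_mul_omega (hG : G.Connected) (i j : Fin n) :
    1 ≤ (shiftedLap G).det * (shiftedLap G)⁻¹ i j := by
  have h1 : (shiftedLap G).det * (shiftedLap G)⁻¹ i j = (shiftedLap G).adjugate i j := by
    rw [Matrix.inv_def, Matrix.smul_apply, smul_eq_mul, Ring.inverse_eq_inv',
      mul_inv_cancel_left₀ (det_shiftedLap_pos G).ne']
  have h2 : shiftedLap G = (1 + G.lapMatrix ℤ).map (Int.castRingHom ℝ) := by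
    ext a b
    by_cases hab : a = b
    · subst hab
      simp [shiftedLap, SimpleGraph.lapMatrix, SimpleGraph.degMatrix, Matrix.map_apply]
    · simp [shiftedLap, SimpleGraph.lapMatrix, SimpleGraph.degMatrix, Matrix.map_apply, hab,
        SimpleGraph.adjMatrix_apply]
  have h3 : (shiftedLap G).adjugate i j = (((1 + G.lapMatrix ℤ).adjugate i j : ℤ) : ℝ) := by
    rw [h2]
    have := (Int.castRingHom ℝ).map_adjugate (1 + G.lapMatrix ℤ)
    exact (congrFun (congrFun this i) j).symm
  have h4 : 0 < (shiftedLap G).det * (shiftedLap G)⁻¹ i j :=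
    mul_pos (det_shiftedLap_pos G) (omega_pos hG i j)
  rw [h1, h3] at h4 ⊢
  have h5 : 0 < (1 + G.lapMatrix ℤ).adjugate i j := by exact_mod_cast h4
  exact_mod_cast h5

variable (G) in
-- Row `i` of `(I + L) Ω e_i = e_i` has nonpositive off-diagonal terms, so its diagonal term is at
-- least `1`, with coefficient at most `n + 1`.
lemma omega_diag_ge (i : Fin n) : 1 / ((n : ℝ) + 1) ≤ (shiftedLap G)⁻¹ i i := by
  have hS := congrFun (shiftedLap_mulVec_omegaCol (G := G) i) i
  rw [Pi.single_eq_same] at hS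
  change ∑ a, shiftedLap G i a * omegaCol G i a = 1 at hS
  rw [← Finset.add_sum_erase _ _ (Finset.mem_univ i)] at hS
  have h1 : ∑ a ∈ Finset.univ.erase i, shiftedLap G i a * omegaCol G i a ≤ 0 :=
    Finset.sum_nonpos fun a ha => mul_nonpos_of_nonpos_of_nonneg
      (shiftedLap_nonpos_of_ne (Finset.ne_of_mem_erase ha).symm) (omega_nonneg G a i)
  have h2 := mul_le_mul_of_nonneg_right (shiftedLap_self_le (G := G) i) (omega_nonneg G i i)
  have h3 : omegaCol G i i = (shiftedLap G)⁻¹ i i := rfl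
  rw [h3] at hS
  rw [div_le_iff₀ (by positivity)]
  linarith

/-- `Ω_ii = ‖B Ω e_i‖² + ‖Ω e_i‖²`. -/
lemma omega_diag_eq (edges : EdgeList G m) (i : Fin n) :
    (shiftedLap G)⁻¹ i i = edgeDiff edges (omegaCol G i) ⬝ᵥ edgeDiff edges (omegaCol G i) +
      omegaCol G i ⬝ᵥ omegaCol G i := by
  -- The form of `I + L` at `Ω e_i` is `e_i ⬝ᵥ Ω e_i` on one side and splits into the parts of `I`
  -- and `L = BᵀB` on the other.
  have h := dotProduct_shiftedLap_mulVec (G := G) (omegaCol G i) (omegaCol G i)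
  rw [shiftedLap_mulVec_omegaCol, dotProduct_lap_mulVec edges, dotProduct_single, mul_one] at h
  rw [add_comm, ← h]
  rfl

/-- Together with `omega_diag_ge` this bounds `‖Ωe_i‖` below by `1/(n+1)`, the scale against which
solver errors are measured. -/
lemma sq_omega_diag_le (i : Fin n) :
    (shiftedLap G)⁻¹ i i ^ 2 ≤ omegaCol G i ⬝ᵥ omegaCol G i := by
  rw [pow_two]
  exact Finset.single_le_sum (f := fun j => omegaCol G i j * omegaCol G i j)
    (fun j _ => mul_self_nonneg _) (Finset.mem_univ i)

/-! ### Size of the graph -/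

lemma le_edges_add_one (hG : G.Connected) (edges : EdgeList G m) : n ≤ m + 1 := by
  have h := hG.card_vert_le_card_edgeSet_add_one
  rw [Nat.card_eq_fintype_card, Fintype.card_fin] at h
  refine h.trans (Nat.add_le_add_right ?_ 1)
  have hs : Function.Surjective
      (fun e : Fin m => (⟨s(edges.head e, edges.tail e), edges.adj e⟩ : G.edgeSet)) := by
    rintro ⟨x, hx⟩
    induction x using Sym2.ind with
    | _ i j =>
      obtain ⟨e, he⟩ := edges.surj i j hx
      exact ⟨e, Subtype.ext he⟩
  simpa using Nat.card_le_card_of_surjective _ hs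

/-- Every nonzero position is diagonal or one of the two orientations of a listed edge. -/
lemma nnz_shiftedLap_le (edges : EdgeList G m) : nnz (shiftedLap G) ≤ n + 2 * m := by
  have hsub : {x : Fin n × Fin n | shiftedLap G x.1 x.2 ≠ 0} ⊆
      Set.range (Sum.elim (fun i : Fin n => (i, i)) (Sum.elim
        (fun e : Fin m => (edges.head e, edges.tail e))
        (fun e : Fin m => (edges.tail e, edges.head e)))) := by
    rintro ⟨i, j⟩ h
    by_cases hij : i = j
    · exact ⟨Sum.inl i, by simp [hij]⟩
    · simp only [Set.mem_ofPred_eq, shiftedLap_of_ne hij] at h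
      have hadj : G.Adj i j := by
        by_contra hc
        simp [hc] at h
      obtain ⟨e, he⟩ := edges.surj i j hadj
      rcases Sym2.eq_iff.mp he with ⟨h1, h2⟩ | ⟨h1, h2⟩
      · exact ⟨Sum.inr (Sum.inl e), by simp [h1, h2]⟩
      · exact ⟨Sum.inr (Sum.inr e), by simp [h1, h2]⟩
  refine (Set.ncard_le_ncard hsub (Set.finite_range _)).trans ?_
  rw [← Set.image_univ]
  refine (Set.ncard_image_le Set.finite_univ).trans ?_
  rw [Set.ncard_univ, Nat.card_eq_fintype_card]
  simp
  omega

end Omega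

/-! ### Concentration of random projections -/

section Moments

variable {Ω : Type*} [MeasurableSpace Ω] {μ : Measure Ω} [IsProbabilityMeasure μ] {Z : Ω → ℝ}

lemma lintegral_exp_sq_gaussian {t : ℝ} (ht : 2 * t < 1) :
    ∫⁻ g, ENNReal.ofReal (Real.exp (t * g ^ 2)) ∂gaussianReal 0 1 =
      ENNReal.ofReal (√(1 / (1 - 2 * t))) := by
  have hb : 0 < 1 / 2 - t := by linarith
  have hpdf : ∀ g : ℝ, gaussianPDFReal 0 1 g * Real.exp (t * g ^ 2) =
      (√(2 * Real.pi))⁻¹ * Real.exp (-(1 / 2 - t) * g ^ 2) := by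
    intro g
    rw [gaussianPDFReal_def]
    simp only [NNReal.coe_one, mul_one, sub_zero]
    rw [mul_assoc, ← Real.exp_add]
    congr 2
    ring
  rw [gaussianReal_of_var_ne_zero 0 one_ne_zero,
    lintegral_withDensity_eq_lintegral_mul _ (measurable_gaussianPDF 0 1) (by fun_prop)]
  have h1 : ∀ g : ℝ, (gaussianPDF 0 1 * fun g => ENNReal.ofReal (Real.exp (t * g ^ 2))) g =
      ENNReal.ofReal ((√(2 * Real.pi))⁻¹ * Real.exp (-(1 / 2 - t) * g ^ 2)) := by
    intro g
    rw [← hpdf, Pi.mul_apply, gaussianPDF, ENNReal.ofReal_mul (gaussianPDFReal_nonneg 0 1 g)]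
  simp only [h1]
  rw [← ofReal_integral_eq_lintegral_ofReal ((integrable_exp_neg_mul_sq hb).const_mul _)
    (ae_of_all _ fun g => by positivity), integral_const_mul, integral_gaussian]
  congr 1
  rw [← Real.sqrt_inv, ← Real.sqrt_mul (by positivity)]
  congr 1
  have : (1 : ℝ) - 2 * t ≠ 0 := by linarith
  have : (1 : ℝ) / 2 - t ≠ 0 := hb.ne'
  have := Real.pi_pos.ne'
  field_simp

lemma lintegral_exp_mul_gaussian (t : ℝ) :
    ∫⁻ g, ENNReal.ofReal (Real.exp (t * g)) ∂gaussianReal 0 1 =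
      ENNReal.ofReal (Real.exp (t ^ 2 / 2)) := by
  rw [← ofReal_integral_eq_lintegral_ofReal (integrable_exp_mul_gaussianReal t)
    (ae_of_all _ fun g => (Real.exp_pos _).le)]
  have := mgf_gaussianReal (p := gaussianReal 0 1) (X := id) (μ := 0) (v := 1) (by simp) t
  simp only [mgf, id] at this
  rw [this]
  simp

/-- The square of a sub-Gaussian variable is dominated by the square of a Gaussian. -/
lemma lintegral_exp_sq_le (hZm : Measurable Z) (hZ : HasSubgaussianMGF Z 1 μ) {t : ℝ}
    (ht0 : 0 ≤ t) (ht : 2 * t < 1) :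
    ∫⁻ ω, ENNReal.ofReal (Real.exp (t * Z ω ^ 2)) ∂μ ≤ ENNReal.ofReal (√(1 / (1 - 2 * t))) := by
  rw [← lintegral_exp_sq_gaussian ht]
  have hsq : √(2 * t) ^ 2 = 2 * t := Real.sq_sqrt (by linarith)
  calc ∫⁻ ω, ENNReal.ofReal (Real.exp (t * Z ω ^ 2)) ∂μ
      -- Linearization: `exp (t z²)` is the moment generating function of a standard Gaussian `g` at
      -- `√(2t) z`. After the swap, the sub-Gaussian bound applies for each fixed `g`.
      = ∫⁻ ω, ∫⁻ g, ENNReal.ofReal (Real.exp (√(2 * t) * Z ω * g)) ∂gaussianReal 0 1 ∂μ := by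
        refine lintegral_congr fun ω => ?_
        rw [lintegral_exp_mul_gaussian, mul_pow, hsq]
        congr 2
        ring
    _ = ∫⁻ g, ∫⁻ ω, ENNReal.ofReal (Real.exp (√(2 * t) * Z ω * g)) ∂μ ∂gaussianReal 0 1 :=
        lintegral_lintegral_swap (by fun_prop)
    _ ≤ ∫⁻ g, ENNReal.ofReal (Real.exp (t * g ^ 2)) ∂gaussianReal 0 1 := by
        refine lintegral_mono fun g => ?_
        have h1 : ∀ ω, √(2 * t) * Z ω * g = (√(2 * t) * g) * Z ω := fun ω => by ring
        simp only [h1]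
        rw [← ofReal_integral_eq_lintegral_ofReal (hZ.integrable_exp_mul _)
          (ae_of_all _ fun ω => (Real.exp_pos _).le)]
        refine ENNReal.ofReal_le_ofReal ((hZ.mgf_le _).trans (le_of_eq ?_))
        rw [mul_pow, hsq]
        congr 1
        simp
        ring

lemma quartic_le_cosh (u : ℝ) : 1 + u ^ 2 / 2 + u ^ 4 / 24 ≤ Real.cosh u := by
  have h := sum_le_hasSum (Finset.range 3)
    (fun n _ => div_nonneg (Even.pow_nonneg (even_two_mul n) u) (Nat.cast_nonneg _))
    (Real.hasSum_cosh u)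
  simp [Finset.sum_range_succ, Nat.factorial] at h
  linarith

lemma integrable_pow_of_subgaussian (hZ : HasSubgaussianMGF Z 1 μ) (k : ℕ) :
    Integrable (fun ω => Z ω ^ k) μ := by
  rcases Nat.eq_zero_or_pos k with rfl | hk
  · simp
  · have h := (hZ.memLp k).integrable_norm_pow (by omega)
    refine h.mono (hZ.aestronglyMeasurable.pow k) (ae_of_all _ fun ω => ?_)
    simp

/-- The sub-Gaussian bound at `±1/4` gives `E cosh (Z/4) ≤ e^(1/32)`. The quartic Taylor polynomial
of `cosh` lies below it, and its quadratic part is fixed by the variance, so the fourth moment is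
bounded. -/
lemma integral_pow_four_le (hZ : HasSubgaussianMGF Z 1 μ) (h2 : ∫ ω, Z ω ^ 2 ∂μ = 1) :
    ∫ ω, Z ω ^ 4 ∂μ ≤ 31 / 10 := by
  have hi1 := hZ.integrable_exp_mul (1 / 4)
  have hi2 := hZ.integrable_exp_mul (-(1 / 4))
  have hcosh : ∫ ω, Real.cosh (1 / 4 * Z ω) ∂μ ≤ Real.exp (1 / 32) := by
    have h1 : ∀ ω, Real.cosh (1 / 4 * Z ω) =
        (Real.exp (1 / 4 * Z ω) + Real.exp (-(1 / 4) * Z ω)) / 2 := by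
      intro ω; rw [Real.cosh_eq, neg_mul]
    simp only [h1]
    rw [integral_div, integral_add hi1 hi2]
    have e1 := hZ.mgf_le (1 / 4)
    have e2 := hZ.mgf_le (-(1 / 4))
    have e3 : Real.exp (((1 : ℝ≥0) : ℝ) * (1 / 4) ^ 2 / 2) = Real.exp (1 / 32) := by
      congr 1; norm_num
    have e4 : Real.exp (((1 : ℝ≥0) : ℝ) * (-(1 / 4)) ^ 2 / 2) = Real.exp (1 / 32) := by
      congr 1; norm_num
    rw [e3] at e1
    rw [e4] at e2
    simp only [mgf] at e1 e2
    linarith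
  have hicosh : Integrable (fun ω => Real.cosh (1 / 4 * Z ω)) μ := by
    have h1 : ∀ ω, Real.cosh (1 / 4 * Z ω) =
        (Real.exp (1 / 4 * Z ω) + Real.exp (-(1 / 4) * Z ω)) / 2 := by
      intro ω; rw [Real.cosh_eq, neg_mul]
    simp only [h1]
    exact (hi1.add hi2).div_const 2
  have hp2 := integrable_pow_of_subgaussian hZ 2
  have hp4 := integrable_pow_of_subgaussian hZ 4
  have hlow : ∫ ω, (1 + 1 / 32 * Z ω ^ 2 + 1 / 6144 * Z ω ^ 4) ∂μ ≤
      ∫ ω, Real.cosh (1 / 4 * Z ω) ∂μ := by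
    refine integral_mono (((integrable_const 1).add (hp2.const_mul _)).add (hp4.const_mul _))
      hicosh fun ω => ?_
    have := quartic_le_cosh (1 / 4 * Z ω)
    ring_nf at this ⊢
    linarith
  rw [integral_add (f := fun ω => 1 + 1 / 32 * Z ω ^ 2)
      ((integrable_const 1).add (hp2.const_mul _)) (hp4.const_mul _),
    integral_add (integrable_const 1) (hp2.const_mul _), integral_const_mul, integral_const_mul,
    h2] at hlow
  simp only [integral_const, probReal_univ, smul_eq_mul, mul_one] at hlow
  have hexp : Real.exp (1 / 32) ≤ 1 + 1 / 32 + 1 / 2048 + 1 / 100000 := by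
    have := Real.exp_bound' (x := 1 / 32) (by norm_num) (by norm_num) (n := 3) (by norm_num)
    simp [Finset.sum_range_succ, Nat.factorial] at this
    norm_num at this ⊢
    linarith
  linarith

/-- Laplace transform of the square of a sub-Gaussian variable of variance one. -/
lemma lintegral_exp_neg_sq_le (hZ : HasSubgaussianMGF Z 1 μ) (h2 : ∫ ω, Z ω ^ 2 ∂μ = 1)
    {t : ℝ} (ht0 : 0 ≤ t) :
    ∫⁻ ω, ENNReal.ofReal (Real.exp (-t * Z ω ^ 2)) ∂μ ≤
      ENNReal.ofReal (1 - t + 31 / 20 * t ^ 2) := by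
  have hp2 := integrable_pow_of_subgaussian hZ 2
  have hp4 := integrable_pow_of_subgaussian hZ 4
  -- At `x = t Z²` the quadratic term brings in the fourth moment; `31/20` is half of its bound
  -- `31/10`.
  have hq : ∀ x : ℝ, 0 ≤ x → Real.exp (-x) ≤ 1 - x + x ^ 2 / 2 := by
    intro x hx
    rw [Real.exp_neg, inv_le_comm₀ (Real.exp_pos _) (by nlinarith [sq_nonneg (x - 1)])]
    refine le_trans ?_ (Real.quadratic_le_exp_of_nonneg hx)
    rw [inv_le_iff_one_le_mul₀ (by nlinarith [sq_nonneg (x - 1)])]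
    nlinarith [sq_nonneg (x ^ 2)]
  have hintegrable : Integrable (fun ω => 1 - t * Z ω ^ 2 + t ^ 2 / 2 * Z ω ^ 4) μ :=
    ((integrable_const 1).sub (hp2.const_mul _)).add (hp4.const_mul _)
  have hpt : ∀ ω, Real.exp (-t * Z ω ^ 2) ≤ 1 - t * Z ω ^ 2 + t ^ 2 / 2 * Z ω ^ 4 := by
    intro ω
    have := hq (t * Z ω ^ 2) (by positivity)
    rw [neg_mul]
    refine this.trans (le_of_eq (by ring))
  calc ∫⁻ ω, ENNReal.ofReal (Real.exp (-t * Z ω ^ 2)) ∂μ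
      ≤ ∫⁻ ω, ENNReal.ofReal (1 - t * Z ω ^ 2 + t ^ 2 / 2 * Z ω ^ 4) ∂μ :=
        lintegral_mono fun ω => ENNReal.ofReal_le_ofReal (hpt ω)
    _ = ENNReal.ofReal (∫ ω, (1 - t * Z ω ^ 2 + t ^ 2 / 2 * Z ω ^ 4) ∂μ) :=
        (ofReal_integral_eq_lintegral_ofReal hintegrable
          (ae_of_all _ fun ω => (Real.exp_pos _).le.trans (hpt ω))).symm
    _ ≤ _ := by
        refine ENNReal.ofReal_le_ofReal ?_
        rw [integral_add (f := fun ω => 1 - t * Z ω ^ 2)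
            ((integrable_const 1).sub (hp2.const_mul _)) (hp4.const_mul _),
          integral_sub (integrable_const 1) (hp2.const_mul _), integral_const_mul,
          integral_const_mul, h2]
        simp only [integral_const, probReal_univ, smul_eq_mul, mul_one]
        nlinarith [integral_pow_four_le hZ h2, sq_nonneg t]

/-- The Chernoff bound for a sum of i.i.d. variables. -/
lemma chernoff_pi {p : ℕ} {F : Ω → ℝ} (hF : Measurable F) {c : ℝ}
    (h : ∫⁻ ω, ENNReal.ofReal (Real.exp (F ω)) ∂μ ≤ ENNReal.ofReal (Real.exp c)) (a : ℝ) :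
    (Measure.pi fun _ : Fin p => μ) {x | a ≤ ∑ r, F (x r)} ≤
      ENNReal.ofReal (Real.exp (p * c - a)) := by
  have hind : iIndepFun (fun (r : Fin p) (x : Fin p → Ω) => ENNReal.ofReal (Real.exp (F (x r))))
      (Measure.pi fun _ : Fin p => μ) :=
    iIndepFun_pi (X := fun _ ω => ENNReal.ofReal (Real.exp (F ω)))
      (fun _ => (by fun_prop : Measurable fun ω => ENNReal.ofReal (Real.exp (F ω))).aemeasurable)
  have hprod := lintegral_prod_eq_prod_lintegral_of_indepFun Finset.univ _ hind
    (fun r => by fun_prop)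
  have heval : ∀ r : Fin p, ∫⁻ x, ENNReal.ofReal (Real.exp (F (x r)))
      ∂(Measure.pi fun _ : Fin p => μ) = ∫⁻ ω, ENNReal.ofReal (Real.exp (F ω)) ∂μ := fun r =>
    (measurePreserving_eval (fun _ : Fin p => μ) r).lintegral_comp
      (f := fun ω => ENNReal.ofReal (Real.exp (F ω))) (by fun_prop)
  have hset : {x : Fin p → Ω | a ≤ ∑ r, F (x r)} =
      {x | ENNReal.ofReal (Real.exp a) ≤ ∏ r, ENNReal.ofReal (Real.exp (F (x r)))} := by
    ext x
    simp only [Set.mem_ofPred_eq]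
    rw [← ENNReal.ofReal_prod_of_nonneg fun _ _ => (Real.exp_pos _).le, ← Real.exp_sum,
      ENNReal.ofReal_le_ofReal_iff (Real.exp_pos _).le, Real.exp_le_exp]
  rw [hset]
  have hmeas : Measurable fun x : Fin p → Ω => ∏ r, ENNReal.ofReal (Real.exp (F (x r))) := by
    fun_prop
  refine (meas_ge_le_lintegral_div hmeas.aemeasurable (by simp [Real.exp_pos]) (by simp)).trans ?_
  rw [hprod, Finset.prod_congr rfl fun r _ => heval r, Finset.prod_const, Finset.card_univ,
    Fintype.card_fin, Real.exp_sub, ENNReal.ofReal_div_of_pos (Real.exp_pos _)]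
  gcongr
  refine (pow_le_pow_left' h p).trans (le_of_eq ?_)
  rw [← ENNReal.ofReal_pow (Real.exp_pos _).le, ← Real.exp_nat_mul]

/-- The series of `-log (1 - x) / 2` begins `x/2 + x²/4 + x³/6`; on this range `x³/2` covers the
cubic and all later terms. -/
lemma sqrt_inv_one_sub_le {x : ℝ} (h0 : 0 ≤ x) (h1 : x ≤ 1 / 24) :
    √(1 / (1 - x)) ≤ Real.exp (x / 2 + x ^ 2 / 4 + x ^ 3 / 2) := by
  refine Real.sqrt_le_iff.mpr ⟨(Real.exp_pos _).le, ?_⟩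
  rw [← Real.exp_nat_mul, div_le_iff₀ (by linarith)]
  have hy : (0 : ℝ) ≤ x + x ^ 2 / 2 + x ^ 3 := by positivity
  have e : ((2 : ℕ) : ℝ) * (x / 2 + x ^ 2 / 4 + x ^ 3 / 2) = x + x ^ 2 / 2 + x ^ 3 := by
    push_cast; ring
  rw [e]
  have h3 := Real.quadratic_le_exp_of_nonneg hy
  have h4 : 1 ≤ (1 + (x + x ^ 2 / 2 + x ^ 3) + (x + x ^ 2 / 2 + x ^ 3) ^ 2 / 2) * (1 - x) := by
    have : (1 + (x + x ^ 2 / 2 + x ^ 3) + (x + x ^ 2 / 2 + x ^ 3) ^ 2 / 2) * (1 - x) - 1 =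
        x ^ 3 * (1 / 2 - 3 / 8 * x - 5 / 8 * x ^ 2 - x ^ 4 / 2) := by ring
    have h5 : 0 ≤ 1 / 2 - 3 / 8 * x - 5 / 8 * x ^ 2 - x ^ 4 / 2 := by
      have h6 : x ^ 2 ≤ 1 := by nlinarith
      have h7 : x ^ 4 ≤ x ^ 2 := by nlinarith [sq_nonneg x]
      nlinarith
    nlinarith [mul_nonneg (pow_nonneg h0 3) h5]
  have h8 : (1 : ℝ) - x ≥ 0 := by linarith
  nlinarith [mul_le_mul_of_nonneg_right h3 h8]

/-- To second order the exponent needs only `31/20 - 1/2 = 21/20`; the slack up to `11/10` absorbs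
the cubic error. -/
lemma one_sub_add_le_exp {t : ℝ} (h0 : 0 ≤ t) (h1 : t ≤ 1 / 48) :
    1 - t + 31 / 20 * t ^ 2 ≤ Real.exp (-t + 11 / 10 * t ^ 2) := by
  have hz : 0 ≤ t - 11 / 10 * t ^ 2 := by nlinarith
  have h3 := Real.exp_bound (x := -t + 11 / 10 * t ^ 2) (n := 3)
    (by rw [abs_le]; constructor <;> nlinarith) (by norm_num)
  simp [Finset.sum_range_succ, Nat.factorial] at h3
  have h4 : |-t + 11 / 10 * t ^ 2| ^ 3 ≤ t ^ 3 := by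
    refine pow_le_pow_left₀ (abs_nonneg _) ?_ 3
    rw [abs_le]; constructor <;> nlinarith
  have h5 := (abs_le.mp h3).1
  have h6 : t ^ 3 ≤ t ^ 2 / 48 := by nlinarith [sq_nonneg t]
  nlinarith [sq_nonneg t, sq_nonneg (t ^ 2)]

/-- Both tails of the mean of squares of i.i.d. sub-Gaussian variables of variance one. -/
lemma tail_sum_sq {p : ℕ} (hZm : Measurable Z) (hZ : HasSubgaussianMGF Z 1 μ)
    (h2 : ∫ ω, Z ω ^ 2 ∂μ = 1) {β : ℝ} (hβ0 : 0 < β) (hβ : β ≤ 1 / 24) :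
    (Measure.pi fun _ : Fin p => μ) {x | ¬ |∑ r, Z (x r) ^ 2 - p| ≤ β * p} ≤
      2 * ENNReal.ofReal (Real.exp (-(5 / 24) * β ^ 2 * p)) := by
  -- Chernoff parameter `β/2` for both tails. The exponents per sample are `-β²/4 + β³/2` above and
  -- `-9β²/40` below, both at most `-5β²/24`.
  have hup : (Measure.pi fun _ : Fin p => μ)
      {x | β / 2 * (1 + β) * p ≤ ∑ r, β / 2 * Z (x r) ^ 2} ≤
      ENNReal.ofReal (Real.exp (-(5 / 24) * β ^ 2 * p)) := by
    have hm := lintegral_exp_sq_le hZm hZ (t := β / 2) (by linarith) (by linarith)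
    rw [show 2 * (β / 2) = β by ring] at hm
    replace hm := hm.trans (ENNReal.ofReal_le_ofReal (sqrt_inv_one_sub_le hβ0.le hβ))
    refine (chernoff_pi (F := fun ω => β / 2 * Z ω ^ 2) (by fun_prop) hm _).trans (ENNReal.ofReal_le_ofReal
      (Real.exp_le_exp.mpr ?_))
    have h3 : β ^ 3 ≤ β ^ 2 / 24 := by nlinarith [sq_nonneg β]
    nlinarith [Nat.cast_nonneg (α := ℝ) p, sq_nonneg β]
  have hlow : (Measure.pi fun _ : Fin p => μ)
      {x | -(β / 2) * (1 - β) * p ≤ ∑ r, -(β / 2) * Z (x r) ^ 2} ≤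
      ENNReal.ofReal (Real.exp (-(5 / 24) * β ^ 2 * p)) := by
    have hm := (lintegral_exp_neg_sq_le hZ h2 (t := β / 2) (by linarith)).trans
      (ENNReal.ofReal_le_ofReal (one_sub_add_le_exp (t := β / 2) (by linarith) (by linarith)))
    refine (chernoff_pi (by fun_prop) hm _).trans (ENNReal.ofReal_le_ofReal
      (Real.exp_le_exp.mpr ?_))
    nlinarith [Nat.cast_nonneg (α := ℝ) p, sq_nonneg β,
      mul_nonneg (Nat.cast_nonneg (α := ℝ) p) (sq_nonneg β)]
  have hsub : {x : Fin p → Ω | ¬ |∑ r, Z (x r) ^ 2 - p| ≤ β * p} ⊆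
      {x | β / 2 * (1 + β) * p ≤ ∑ r, β / 2 * Z (x r) ^ 2} ∪
      {x | -(β / 2) * (1 - β) * p ≤ ∑ r, -(β / 2) * Z (x r) ^ 2} := by
    intro x hx
    simp only [Set.mem_ofPred_eq, not_le, lt_abs] at hx
    simp only [Set.mem_union, Set.mem_ofPred_eq, ← Finset.mul_sum]
    rcases hx with hx | hx
    · left; nlinarith
    · right; nlinarith
  refine (measure_mono hsub).trans ((measure_union_le _ _).trans ?_)
  rw [two_mul]
  exact add_le_add hup hlow

end Moments

/-! ### Sign and Gaussian entries, and the Johnson–Lindenstrauss estimate -/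

section Entries

variable (κ : Sketch) {p : ℕ}

instance instIsProbabilityMeasureEntryLaw (p : ℕ) : IsProbabilityMeasure (κ.entryLaw p) := by
  cases κ with
  | sign =>
    refine ⟨?_⟩
    simp [Sketch.entryLaw, ENNReal.inv_two_add_inv_two]
  | gaussian => simp only [Sketch.entryLaw]; infer_instance

lemma integrable_sign (f : ℝ → ℝ) : Integrable f (Sketch.sign.entryLaw p) := by
  simp only [Sketch.entryLaw]
  exact ((integrable_dirac (by simp)).smul_measure (by simp)).add_measure
    ((integrable_dirac (by simp)).smul_measure (by simp))

lemma integral_sign (f : ℝ → ℝ) :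
    ∫ x, f x ∂(Sketch.sign.entryLaw p) = (f (1 / √p) + f (-(1 / √p))) / 2 := by
  simp only [Sketch.entryLaw]
  rw [integral_add_measure ((integrable_dirac (by simp)).smul_measure (by simp))
    ((integrable_dirac (by simp)).smul_measure (by simp)), integral_smul_measure,
    integral_smul_measure, integral_dirac, integral_dirac]
  simp
  ring

lemma integral_entryLaw : ∫ x, x ∂(κ.entryLaw p) = 0 := by
  cases κ with
  | sign => rw [integral_sign]; ring
  | gaussian => simp [Sketch.entryLaw]

/-- For signs this is `cosh x ≤ exp (x²/2)`; for the Gaussian it is an equality. In both cases the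
parameter equals the variance, so one tail estimate serves both. -/
lemma hasSubgaussianMGF_entryLaw : HasSubgaussianMGF id (p : ℝ≥0)⁻¹ (κ.entryLaw p) := by
  cases κ with
  | sign =>
    refine ⟨fun t => integrable_sign _, fun t => ?_⟩
    simp only [mgf, id]
    rw [integral_sign, mul_neg, ← Real.cosh_eq]
    refine (Real.cosh_le_exp_half_sq _).trans (le_of_eq ?_)
    congr 1
    rw [mul_pow, div_pow, Real.sq_sqrt (Nat.cast_nonneg p)]
    push_cast
    ring
  | gaussian =>
    refine ⟨fun t => integrable_exp_mul_gaussianReal t, fun t => ?_⟩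
    have h := mgf_gaussianReal (p := gaussianReal 0 (p : ℝ≥0)⁻¹) (μ := 0)
      (v := (p : ℝ≥0)⁻¹) (X := id) (by simp) t
    simp only [Sketch.entryLaw]
    rw [h, zero_mul, zero_add]

lemma variance_entryLaw : Var[id; κ.entryLaw p] = (p : ℝ)⁻¹ := by
  cases κ with
  | sign =>
    rw [variance_of_integral_eq_zero aemeasurable_id (integral_entryLaw _)]
    simp only [id]
    rw [integral_sign (p := p) (fun x => x ^ 2)]
    simp
  | gaussian => simp [Sketch.entryLaw, variance_id_gaussianReal]

/-- The Johnson–Lindenstrauss estimate for one vector. -/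
lemma sketch_tail (hp : 0 < p) {d : ℕ} (v : Fin d → ℝ) {β : ℝ} (hβ0 : 0 < β)
    (hβ : β ≤ 1 / 24) :
    (Measure.pi fun _ : Fin p => Measure.pi fun _ : Fin d => κ.entryLaw p)
      {P | ¬ |∑ r, (P r ⬝ᵥ v) ^ 2 - v ⬝ᵥ v| ≤ β * (v ⬝ᵥ v)} ≤
      2 * ENNReal.ofReal (Real.exp (-(5 / 24) * β ^ 2 * p)) := by
  have hp' : (0 : ℝ) < p := by exact_mod_cast hp
  by_cases hv : v = 0
  · subst hv
    simp
  have hV : 0 < v ⬝ᵥ v := by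
    refine lt_of_le_of_ne (dotProduct_self_nonneg' v) (fun h => hv ?_)
    exact dotProduct_self_eq_zero.mp h.symm
  set V := v ⬝ᵥ v with hVdef
  -- This scaling gives `c (P_r ⬝ᵥ v)` variance and sub-Gaussian parameter one.
  set c : ℝ := √(p / V) with hc
  have hc2 : c ^ 2 = p / V := Real.sq_sqrt (by positivity)
  set Z : (Fin d → ℝ) → ℝ := fun x => ∑ i, c * v i * x i with hZdef
  have hZeq : ∀ x, Z x = c * (x ⬝ᵥ v) := by
    intro x
    simp only [hZdef, dotProduct, Finset.mul_sum]
    exact Finset.sum_congr rfl fun i _ => by ring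
  have hentry := hasSubgaussianMGF_entryLaw κ (p := p)
  have hsumsq : ∑ i, (c * v i) ^ 2 * (p : ℝ)⁻¹ = 1 := by
    have : ∀ i, (c * v i) ^ 2 * (p : ℝ)⁻¹ = (c ^ 2 * (p : ℝ)⁻¹) * (v i * v i) := by
      intro i; ring
    simp only [this, ← Finset.mul_sum]
    rw [hc2]
    change p / V * (p : ℝ)⁻¹ * V = 1
    field_simp
  have hZm : Measurable Z := by fun_prop
  have hZ : HasSubgaussianMGF Z 1 (Measure.pi fun _ : Fin d => κ.entryLaw p) := by
    have hind : iIndepFun (fun (i : Fin d) (x : Fin d → ℝ) => c * v i * x i)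
        (Measure.pi fun _ : Fin d => κ.entryLaw p) :=
      iIndepFun_pi (X := fun i y => c * v i * y) (fun i => by fun_prop)
    have hsub : ∀ i ∈ (Finset.univ : Finset (Fin d)),
        HasSubgaussianMGF (fun x : Fin d → ℝ => c * v i * x i)
          (⟨(c * v i) ^ 2, sq_nonneg _⟩ * (p : ℝ≥0)⁻¹)
          (Measure.pi fun _ : Fin d => κ.entryLaw p) := by
      intro i _
      have h1 : HasSubgaussianMGF (id ∘ Function.eval i) (p : ℝ≥0)⁻¹
          (Measure.pi fun _ : Fin d => κ.entryLaw p) := by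
        refine HasSubgaussianMGF.of_map (measurable_pi_apply i).aemeasurable ?_
        rw [(measurePreserving_eval (fun _ : Fin d => κ.entryLaw p) i).map_eq]
        exact hentry
      exact h1.const_mul (c * v i)
    have h := HasSubgaussianMGF.sum_of_iIndepFun hind hsub
    have he : ∑ i, (⟨(c * v i) ^ 2, sq_nonneg _⟩ * (p : ℝ≥0)⁻¹ : ℝ≥0) = 1 := by
      rw [← NNReal.coe_inj]
      push_cast
      exact hsumsq
    rwa [he] at h
  have hZ2 : ∫ x, Z x ^ 2 ∂(Measure.pi fun _ : Fin d => κ.entryLaw p) = 1 := by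
    have hmem : ∀ i : Fin d, MemLp (fun y : ℝ => c * v i * y) 2 (κ.entryLaw p) := fun i =>
      (hentry.memLp 2).const_mul (c * v i)
    have hvar := variance_sum_pi (μ := fun _ : Fin d => κ.entryLaw p)
      (X := fun i y => c * v i * y) hmem
    have hZf : (∑ i, fun x : Fin d → ℝ => c * v i * x i) = Z := by
      funext x
      simp [hZdef, Finset.sum_apply]
    rw [hZf] at hvar
    have hmean : ∫ x, Z x ∂(Measure.pi fun _ : Fin d => κ.entryLaw p) = 0 := by
      simp only [hZdef]
      rw [integral_finsetSum]
      · refine Finset.sum_eq_zero fun i _ => ?_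
        rw [integral_const_mul]
        have := integral_comp_eval (μ := fun _ : Fin d => κ.entryLaw p) (i := i)
          (f := fun y : ℝ => y) (by fun_prop)
        rw [this, integral_entryLaw, mul_zero]
      · intro i _
        exact (measurePreserving_eval (fun _ : Fin d => κ.entryLaw p) i).integrable_comp_of_integrable
          ((hmem i).integrable (by norm_num))
    rw [variance_of_integral_eq_zero hZm.aemeasurable hmean] at hvar
    rw [hvar, ← hsumsq]
    refine Finset.sum_congr rfl fun i _ => ?_
    rw [variance_const_mul]
    congr 1
    exact variance_entryLaw κ
  have h := tail_sum_sq (p := p) hZm hZ hZ2 hβ0 hβ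
  refine (measure_mono ?_).trans h
  intro P hP hcon
  apply hP
  simp only [hZeq, mul_pow, hc2, ← Finset.mul_sum] at hcon
  have hcon' : |p / V * (∑ r, (P r ⬝ᵥ v) ^ 2 - V)| ≤ p / V * (β * V) := by
    have e1 : p / V * (∑ r, (P r ⬝ᵥ v) ^ 2 - V) = p / V * ∑ r, (P r ⬝ᵥ v) ^ 2 - p := by
      field_simp
    have e2 : p / V * (β * V) = β * p := by field_simp
    rw [e1, e2]
    exact hcon
  rw [abs_mul, abs_of_pos (by positivity : (0 : ℝ) < p / V)] at hcon'
  exact le_of_mul_le_mul_left hcon' (by positivity)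

end Entries

/-! ### Sequential experiments on product spaces -/

section Product

variable {Ω Ω' : Type*} [MeasurableSpace Ω] [MeasurableSpace Ω']

/-- The Fubini inequality for a set that need not be measurable. -/
lemma mul_le_measure_prod {μ : Measure Ω} {ν : Measure Ω'} [SFinite ν] {A : Set Ω}
    (hA : MeasurableSet A) {c : ℝ≥0∞} {S : Set (Ω × Ω')}
    (h : ∀ x ∈ A, c ≤ ν {y | (x, y) ∈ S}) : μ A * c ≤ (μ.prod ν) S := by
  rw [← measure_toMeasurable S, Measure.prod_apply (measurableSet_toMeasurable _ _)]
  calc μ A * c = ∫⁻ x, A.indicator (fun _ => c) x ∂μ := by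
        rw [lintegral_indicator_const hA, mul_comm]
    _ ≤ _ := by
        refine lintegral_mono fun x => ?_
        by_cases hx : x ∈ A
        · rw [Set.indicator_of_mem hx]
          exact (h x hx).trans (measure_mono fun y hy => subset_toMeasurable _ _ hy)
        · rw [Set.indicator_of_notMem hx]
          exact zero_le

variable {μ : Measure Ω} [IsProbabilityMeasure μ]

lemma measurePreserving_cons (μ : Measure Ω) [IsProbabilityMeasure μ] (k : ℕ) :
    MeasurePreserving (fun z : Ω × (Fin k → Ω) => (Fin.cons z.1 z.2 : Fin (k + 1) → Ω))
      (μ.prod (Measure.pi fun _ : Fin k => μ)) (Measure.pi fun _ : Fin (k + 1) => μ) := by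
  have h := (measurePreserving_piFinSuccAbove (fun _ : Fin (k + 1) => μ) 0).symm
  convert! h using 1
  funext z
  simp [MeasurableEquiv.piFinSuccAbove, Fin.insertNthEquiv]

lemma mul_le_measure_pi_succ {k : ℕ} {A : Set Ω} (hA : MeasurableSet A) {c : ℝ≥0∞}
    {S : Set (Fin (k + 1) → Ω)}
    (h : ∀ x ∈ A, c ≤ (Measure.pi fun _ : Fin k => μ) {y | (Fin.cons x y : Fin (k + 1) → Ω) ∈ S}) :
    μ A * c ≤ (Measure.pi fun _ : Fin (k + 1) => μ) S := by
  rw [← measure_toMeasurable S,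
    ← (measurePreserving_cons μ k).measure_preimage
      (measurableSet_toMeasurable _ _).nullMeasurableSet]
  exact mul_le_measure_prod hA fun x hx =>
    (h x hx).trans (measure_mono fun y hy => subset_toMeasurable _ _ hy)

/-- This direction of Tonelli needs no measurability, which is not available for the step count of
the whole run. -/
lemma lintegral_pi_succ_le {k : ℕ} (f : (Fin (k + 1) → Ω) → ℝ≥0∞) :
    ∫⁻ x, f x ∂(Measure.pi fun _ : Fin (k + 1) => μ) ≤
      ∫⁻ x, ∫⁻ y, f (Fin.cons x y) ∂(Measure.pi fun _ : Fin k => μ) ∂μ := by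
  rw [← (measurePreserving_cons μ k).map_eq]
  exact (lintegral_map_le _ _).trans (lintegral_prod_le _)

variable {σ : Type}

/-- A loop that stays on course in every iteration with probability at least `q`, whatever has
happened before, stays on course for all `k` iterations with probability at least `q ^ k`. -/
lemma pow_le_measure_loop (step : Ω → σ → Timed σ) (Good : σ → Set Ω)
    (hGood : ∀ st, MeasurableSet (Good st)) (q : ℝ≥0∞) (N : ℕ) (R : ℕ → σ → Prop)
    (hq : ∀ j st, j < N → R j st → q ≤ μ (Good st))
    (hR : ∀ j st ω, j < N → R j st → ω ∈ Good st → R (j + 1) (step ω st).val)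
    (k j : ℕ) (hjk : j + k = N) (st : σ) (hst : R j st) :
    q ^ k ≤ (Measure.pi fun _ : Fin k => μ)
      {τ | R N (Timed.loop k (fun t => step (τ t)) st).val} := by
  induction k generalizing j st with
  | zero =>
    have : {τ : Fin 0 → Ω | R N (Timed.loop 0 (fun t => step (τ t)) st).val} = Set.univ := by
      refine Set.eq_univ_of_forall fun τ => ?_
      obtain rfl : j = N := by omega
      exact hst
    rw [this, measure_univ, pow_zero]
  | succ k ih =>
    have hj : j < N := by omega
    rw [pow_succ']
    -- Condition on the first round: only the event `Good st` must be measurable; the set of later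
    -- successful tapes may be arbitrary.
    refine (mul_le_mul_left (hq j st hj hst) _).trans (mul_le_measure_pi_succ (hGood st) ?_)
    intro ω hω
    refine (ih (j + 1) (by omega) _ (hR j st ω hj hst hω)).trans (measure_mono fun τ hτ => ?_)
    simp only [Set.mem_ofPred_eq] at hτ ⊢
    rw [Timed.val_loop_succ]
    simpa using hτ

lemma lintegral_steps_loop_le (step : Ω → σ → Timed σ) (B : ℝ≥0∞)
    (hB : ∀ st, ∫⁻ ω, ((step ω st).steps : ℝ≥0∞) ∂μ ≤ B) (k : ℕ) (st : σ) :
    ∫⁻ τ, ((Timed.loop k (fun t => step (τ t)) st).steps : ℝ≥0∞)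
      ∂(Measure.pi fun _ : Fin k => μ) ≤ k * (1 + B) := by
  induction k generalizing st with
  | zero => simp [Timed.steps_loop_zero]
  | succ k ih =>
    refine (lintegral_pi_succ_le _).trans ?_
    calc ∫⁻ ω, ∫⁻ τ, ((Timed.loop (k + 1)
          (fun t => step ((Fin.cons ω τ : Fin (k + 1) → Ω) t)) st).steps : ℝ≥0∞)
          ∂(Measure.pi fun _ : Fin k => μ) ∂μ
        ≤ ∫⁻ ω, ((1 + k * (1 + B)) + ((step ω st).steps : ℝ≥0∞)) ∂μ := by
          refine lintegral_mono fun ω => ?_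
          have he : ∀ τ : Fin k → Ω, ((Timed.loop (k + 1)
              (fun t => step ((Fin.cons ω τ : Fin (k + 1) → Ω) t)) st).steps : ℝ≥0∞) =
              (1 + ((step ω st).steps : ℝ≥0∞)) +
              ((Timed.loop k (fun t => step (τ t)) (step ω st).val).steps : ℝ≥0∞) := by
            intro τ
            rw [Timed.steps_loop_succ]
            simp
          simp only [he]
          -- For fixed `ω` the first round is a constant in `τ`, so the integral splits without
          -- measurability of the remaining cost.
          rw [lintegral_add_left measurable_const, lintegral_const, measure_univ, mul_one]
          refine (add_le_add_right (ih _) _).trans (le_of_eq ?_)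
          ring
      _ = (1 + k * (1 + B)) + ∫⁻ ω, ((step ω st).steps : ℝ≥0∞) ∂μ := by
          rw [lintegral_add_left measurable_const, lintegral_const, measure_univ, mul_one]
      _ ≤ (1 + k * (1 + B)) + B := add_le_add_right (hB st) _
      _ = _ := by push_cast; ring

end Product

/-! ### Success of the estimator calls of one round -/

section Calls

variable {n m : ℕ} {G : SimpleGraph (Fin n)} [DecidableRel G.Adj] (E : Estimator.{u})

/-- A call of the estimator meets its error bound. -/
def CallOK (S : Matrix (Fin n) (Fin n) ℝ) (b : Fin n → ℝ) (δ : ℝ) (ω : E.Seed) : Prop :=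
  energyNorm S ((E.run S b δ ω).val - S⁻¹ *ᵥ b) ≤ δ * energyNorm S (S⁻¹ *ᵥ b)

lemma measurable_energyNorm (S : Matrix (Fin n) (Fin n) ℝ) : Measurable (energyNorm S) := by
  unfold energyNorm
  refine Measurable.sqrt (Continuous.measurable ?_)
  exact continuous_id.dotProduct (continuous_const.matrix_mulVec continuous_id)

lemma measurableSet_callOK (S : Matrix (Fin n) (Fin n) ℝ) (δ : ℝ) :
    MeasurableSet {x : (Fin n → ℝ) × E.Seed | CallOK E S x.1 δ x.2} := by
  have hinv : Measurable fun b : Fin n → ℝ => S⁻¹ *ᵥ b :=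
    (continuous_const.matrix_mulVec continuous_id).measurable
  refine measurableSet_le ?_ ?_
  · exact (measurable_energyNorm S).comp
      ((E.measurable_val S δ).sub (hinv.comp measurable_fst))
  · exact ((measurable_energyNorm S).comp (hinv.comp measurable_fst)).const_mul δ

lemma measurableSet_callOK_seed (S : Matrix (Fin n) (Fin n) ℝ) (b : Fin n → ℝ) (δ : ℝ) :
    MeasurableSet {ω | CallOK E S b δ ω} :=
  measurable_prodMk_left (measurableSet_callOK E S δ)

variable {E} in
lemma Estimator.Reliable.le_measure {η : ℕ → ℝ} (hE : E.Reliable η) (b : Fin n → ℝ) {δ : ℝ}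
    (hδ : 0 < δ) :
    ENNReal.ofReal (1 - η n) ≤ E.seedLaw {ω | CallOK E (shiftedLap G) b δ ω} := by
  have h := hE n (shiftedLap G) b δ (isSDDM_shiftedLap G) hδ
  exact (ENNReal.ofReal_le_iff_le_toReal (measure_ne_top _ _)).mpr h

/-- Four seeds, the second of which has a condition that depends on the first. -/
lemma mul_le_measure_four {Ω : Type*} [MeasurableSpace Ω] {μ : Measure Ω}
    [IsProbabilityMeasure μ] {A₀ A₂ A₃ : Set Ω} {A₁ : Ω → Set Ω} (h₀ : MeasurableSet A₀)
    (h₁ : ∀ x, MeasurableSet (A₁ x)) (h₂ : MeasurableSet A₂) (h₃ : MeasurableSet A₃)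
    {c₀ c₁ c₂ c₃ : ℝ≥0∞} (hc₀ : c₀ ≤ μ A₀) (hc₁ : ∀ x ∈ A₀, c₁ ≤ μ (A₁ x)) (hc₂ : c₂ ≤ μ A₂)
    (hc₃ : c₃ ≤ μ A₃) :
    c₀ * (c₁ * (c₂ * c₃)) ≤ (Measure.pi fun _ : Fin 4 => μ)
      {σ | σ 0 ∈ A₀ ∧ σ 1 ∈ A₁ (σ 0) ∧ σ 2 ∈ A₂ ∧ σ 3 ∈ A₃} := by
  refine (mul_le_mul_left hc₀ _).trans (mul_le_measure_pi_succ h₀ fun x₀ hx₀ => ?_)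
  refine (mul_le_mul_left (hc₁ x₀ hx₀) _).trans (mul_le_measure_pi_succ (h₁ x₀) fun x₁ hx₁ => ?_)
  refine (mul_le_mul_left hc₂ _).trans (mul_le_measure_pi_succ h₂ fun x₂ hx₂ => ?_)
  rw [← mul_one c₃]
  refine (mul_le_mul_left hc₃ _).trans (mul_le_measure_pi_succ h₃ fun x₃ hx₃ => ?_)
  rw [← measure_univ (μ := Measure.pi fun _ : Fin 0 => μ)]
  refine measure_mono fun y _ => ?_
  exact ⟨hx₀, hx₁, hx₂, hx₃⟩

variable {ε : ℝ} (edges : EdgeList G m) (δ : Precision G ε) {p : ℕ} (hp : 0 < p) (s : Fin n → ℝ)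

/-- The calls of a round whose results are used meet their error bounds. -/
def CallsOK (P : Fin p → Fin n → ℝ) (Q : Fin p → Fin m → ℝ) (σ : Fin p → Fin 4 → E.Seed) : Prop :=
  (∀ r, CallOK E (shiftedLap G) (edgeDiv edges (Q r)) δ.δ₁ (σ r 2)) ∧
  (∀ r, CallOK E (shiftedLap G) (P r) δ.δ₂ (σ r 3)) ∧
  CallOK E (shiftedLap G) s δ.δ₃ (σ ⟨p - 1, by omega⟩ 0) ∧
  CallOK E (shiftedLap G) (E.run (shiftedLap G) s δ.δ₃ (σ ⟨p - 1, by omega⟩ 0)).val δ.δ₃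
    (σ ⟨p - 1, by omega⟩ 1)

variable {E} in
lemma pow_le_measure_callsOK {η : ℕ → ℝ} (hE : E.Reliable η)
    (P : Fin p → Fin n → ℝ) (Q : Fin p → Fin m → ℝ) :
    ENNReal.ofReal (1 - η n) ^ (2 * p + 2) ≤
      (Measure.pi fun _ : Fin p => Measure.pi fun _ : Fin 4 => E.seedLaw)
        {σ | CallsOK E edges δ hp s P Q σ} := by
  set c := ENNReal.ofReal (1 - η n) with hc
  set last : Fin p := ⟨p - 1, by omega⟩ with hlast
  -- Iterations before the last leave their first two seeds unrestricted, because their `q` and `h`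
  -- are discarded. Hence `c²` for these, `c⁴` for the last one, and `c^(2p + 2)` in all.
  let A : Fin p → Set (Fin 4 → E.Seed) := fun r =>
    {σ | σ 0 ∈ {x | r = last → CallOK E (shiftedLap G) s δ.δ₃ x} ∧
      σ 1 ∈ {y | r = last → CallOK E (shiftedLap G)
        (E.run (shiftedLap G) s δ.δ₃ (σ 0)).val δ.δ₃ y} ∧
      σ 2 ∈ {x | CallOK E (shiftedLap G) (edgeDiv edges (Q r)) δ.δ₁ x} ∧
      σ 3 ∈ {x | CallOK E (shiftedLap G) (P r) δ.δ₂ x}}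
  have hA : ∀ r, (if r = last then c ^ 4 else c ^ 2) ≤
      (Measure.pi fun _ : Fin 4 => E.seedLaw) (A r) := by
    intro r
    have h2 := hE.le_measure (G := G) (edgeDiv edges (Q r)) δ.pos₁
    have h3 := hE.le_measure (G := G) (P r) δ.pos₂
    have m2 := measurableSet_callOK_seed E (shiftedLap G) (edgeDiv edges (Q r)) δ.δ₁
    have m3 := measurableSet_callOK_seed E (shiftedLap G) (P r) δ.δ₂
    by_cases hr : r = last
    · have h := mul_le_measure_four
        (A₀ := {x | r = last → CallOK E (shiftedLap G) s δ.δ₃ x})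
        (A₁ := fun x => {y | r = last → CallOK E (shiftedLap G)
          (E.run (shiftedLap G) s δ.δ₃ x).val δ.δ₃ y})
        (by simpa [hr] using measurableSet_callOK_seed E (shiftedLap G) s δ.δ₃)
        (fun x => by simpa [hr] using measurableSet_callOK_seed E (shiftedLap G) _ δ.δ₃)
        m2 m3 (c₀ := c) (c₁ := c)
        (by simpa [hr] using hE.le_measure (G := G) s δ.pos₃)
        (fun x _ => by simpa [hr] using hE.le_measure (G := G) _ δ.pos₃) h2 h3
      rw [if_pos hr]
      refine le_trans (le_of_eq ?_) h
      ring
    · have h := mul_le_measure_four (μ := E.seedLaw)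
        (A₀ := {x | r = last → CallOK E (shiftedLap G) s δ.δ₃ x})
        (A₁ := fun x => {y | r = last → CallOK E (shiftedLap G)
          (E.run (shiftedLap G) s δ.δ₃ x).val δ.δ₃ y})
        (by simp [hr]) (fun x => by simp [hr]) m2 m3 (c₀ := 1) (c₁ := 1)
        (by simp [hr]) (fun x _ => by simp [hr]) h2 h3
      rw [if_neg hr]
      refine le_trans (le_of_eq ?_) h
      ring
  have hprod : ∏ r, (if r = last then c ^ 4 else c ^ 2) = c ^ (2 * p + 2) := by
    have h1 : ∀ r : Fin p, (if r = last then c ^ 4 else c ^ 2) =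
        c ^ 2 * (if r = last then c ^ 2 else 1) := by
      intro r; split_ifs <;> ring
    simp only [h1, Finset.prod_mul_distrib, Finset.prod_const, Finset.card_univ, Fintype.card_fin,
      Finset.prod_ite_eq', Finset.mem_univ, if_true]
    ring
  rw [← hprod]
  refine (Finset.prod_le_prod' fun r _ => hA r).trans ?_
  rw [← Measure.pi_pi]
  refine measure_mono fun σ hσ => ?_
  have hσ' : ∀ r, σ r ∈ A r := fun r => hσ r (Set.mem_univ r)
  exact ⟨fun r => (hσ' r).2.2.1, fun r => (hσ' r).2.2.2, (hσ' last).1 rfl, (hσ' last).2.1 rfl⟩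

/-! ### Success of the random projections -/

/-- The projection preserves the squared norm of `v` up to the factor `1 ± β`. -/
def SketchOK {d : ℕ} (β : ℝ) (P : Fin p → Fin d → ℝ) (v : Fin d → ℝ) : Prop :=
  |∑ r, (P r ⬝ᵥ v) ^ 2 - v ⬝ᵥ v| ≤ β * (v ⬝ᵥ v)

lemma measurableSet_forall {α ι : Type*} [MeasurableSpace α] [Countable ι] {S : ι → α → Prop}
    (h : ∀ i, MeasurableSet {x | S i x}) : MeasurableSet {x | ∀ i, S i x} := by
  rw [show {x | ∀ i, S i x} = ⋂ i, {x | S i x} by ext; simp]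
  exact MeasurableSet.iInter h

lemma measurableSet_sketchOK {d : ℕ} (β : ℝ) (v : Fin d → ℝ) :
    MeasurableSet {P : Fin p → Fin d → ℝ | SketchOK β P v} := by
  unfold SketchOK
  refine measurableSet_le ?_ measurable_const
  refine Continuous.measurable ?_
  simp only [dotProduct]
  fun_prop

lemma sketchDim_pos {ε : ℝ} (hn : 2 ≤ n) (hε : 0 < ε) : 0 < sketchDim n ε := by
  refine Nat.ceil_pos.mpr ?_
  have : 0 < Real.log n := Real.log_pos (by exact_mod_cast hn)
  positivity

/-- All `n` vectors are preserved, except with probability `2 / n⁴`. -/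
lemma le_measure_sketchOK (κ : Sketch) {ε : ℝ} (hn : 2 ≤ n) (hε : 0 < ε) (hε2 : ε ≤ 1 / 2) {d : ℕ}
    (v : Fin n → Fin d → ℝ) :
    ENNReal.ofReal (1 - 2 / (n : ℝ) ^ 4) ≤
      (Measure.pi fun _ : Fin (sketchDim n ε) => Measure.pi fun _ : Fin d =>
        κ.entryLaw (sketchDim n ε)) {P | ∀ i, SketchOK (ε / 12) P (v i)} := by
  have hn0 : (0 : ℝ) < n := by exact_mod_cast (by omega : 0 < n)
  set p := sketchDim n ε with hpdef
  set ν := (Measure.pi fun _ : Fin p => Measure.pi fun _ : Fin d => κ.entryLaw p)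
  -- With `β = ε/12`, the `24 log n / β²` rows and the rate `5β²/24` give `n⁻⁵`; the union bound
  -- over `n` vectors costs one factor `n`.
  have hexp : Real.exp (-(5 / 24) * (ε / 12) ^ 2 * p) ≤ 1 / (n : ℝ) ^ 5 := by
    have h1 : 24 * Real.log n / (ε / 12) ^ 2 ≤ p := Nat.le_ceil _
    rw [div_le_iff₀ (by positivity)] at h1
    have h2 : (1 : ℝ) / (n : ℝ) ^ 5 = Real.exp (-(5 * Real.log n)) := by
      rw [Real.exp_neg, mul_comm, Real.exp_mul, Real.exp_log hn0, one_div]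
      norm_cast
    rw [h2]
    refine Real.exp_le_exp.mpr ?_
    linarith
  have hmeas : ∀ i, MeasurableSet {P : Fin p → Fin d → ℝ | SketchOK (ε / 12) P (v i)} :=
    fun i => measurableSet_sketchOK _ _
  have hset : {P : Fin p → Fin d → ℝ | ∀ i, SketchOK (ε / 12) P (v i)} =
      (⋃ i, {P | ¬ SketchOK (ε / 12) P (v i)})ᶜ := by
    ext P; simp
  have hbad : ν (⋃ i, {P | ¬ SketchOK (ε / 12) P (v i)}) ≤ ENNReal.ofReal (2 / (n : ℝ) ^ 4) := by
    refine (measure_iUnion_fintype_le _ _).trans ?_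
    calc ∑ i, ν {P | ¬ SketchOK (ε / 12) P (v i)}
        ≤ ∑ _i : Fin n, ENNReal.ofReal (2 * (1 / (n : ℝ) ^ 5)) := by
          refine Finset.sum_le_sum fun i _ => ?_
          refine (sketch_tail κ (sketchDim_pos hn hε) (v i) (by positivity)
            (by linarith)).trans ?_
          rw [ENNReal.ofReal_mul two_pos.le, ENNReal.ofReal_ofNat]
          gcongr
      _ = ENNReal.ofReal (2 / (n : ℝ) ^ 4) := by
          rw [Finset.sum_const, Finset.card_univ, Fintype.card_fin, nsmul_eq_mul,
            ← ENNReal.ofReal_natCast, ← ENNReal.ofReal_mul hn0.le]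
          congr 1
          field_simp
  have hmeasU : MeasurableSet (⋃ i, {P : Fin p → Fin d → ℝ | ¬ SketchOK (ε / 12) P (v i)}) :=
    MeasurableSet.iUnion fun i => (hmeas i).compl
  rw [hset, prob_compl_eq_one_sub hmeasU,
    ENNReal.ofReal_sub _ (by positivity), ENNReal.ofReal_one]
  exact tsub_le_tsub_left hbad 1

/-! ### Success of one round -/

/-- Law of the randomness of one round. -/
def roundLaw (κ : Sketch) (n m p : ℕ) : Measure (RoundTape n m p E.Seed) :=
  (Measure.pi fun _ => Measure.pi fun _ => κ.entryLaw p).prod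
    ((Measure.pi fun _ => Measure.pi fun _ => κ.entryLaw p).prod
      (Measure.pi fun _ => Measure.pi fun _ => E.seedLaw))

instance (κ : Sketch) (n m p : ℕ) : IsProbabilityMeasure (roundLaw E κ n m p) := by
  unfold roundLaw; infer_instance

/-- The round succeeds: the projections preserve the norms of the columns of `Ω` and `B Ω`, and the
calls whose results are used meet their error bounds. -/
def RoundOK (τ : RoundTape n m p E.Seed) : Prop :=
  (∀ i, SketchOK (ε / 12) τ.1 (omegaCol G i)) ∧
  (∀ i, SketchOK (ε / 12) τ.2.1 (edgeDiff edges (omegaCol G i))) ∧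
  CallsOK E edges δ hp s τ.1 τ.2.1 τ.2.2

/-- Right-hand sides such as `Bᵀ Q_r` and `q` are themselves random, hence the joint measurability
of the solver in right-hand side and seed. -/
lemma measurableSet_roundOK : MeasurableSet {τ | RoundOK E edges δ hp s τ} := by
  have hseed : ∀ (r : Fin p) (a : Fin 4),
      Measurable fun τ : RoundTape n m p E.Seed => τ.2.2 r a := fun r a => by fun_prop
  have h1 : MeasurableSet {τ : RoundTape n m p E.Seed |
      ∀ i, SketchOK (ε / 12) τ.1 (omegaCol G i)} :=
    measurableSet_forall fun i => measurable_fst (measurableSet_sketchOK _ _)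
  have h2 : MeasurableSet {τ : RoundTape n m p E.Seed |
      ∀ i, SketchOK (ε / 12) τ.2.1 (edgeDiff edges (omegaCol G i))} :=
    measurableSet_forall fun i =>
      (measurable_fst.comp measurable_snd) (measurableSet_sketchOK _ _)
  have h3 : MeasurableSet {τ : RoundTape n m p E.Seed |
      ∀ r, CallOK E (shiftedLap G) (edgeDiv edges (τ.2.1 r)) δ.δ₁ (τ.2.2 r 2)} := by
    refine measurableSet_forall fun r => ?_
    have : Measurable fun τ : RoundTape n m p E.Seed =>
        (edgeDiv edges (τ.2.1 r), τ.2.2 r 2) :=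
      ((measurable_edgeDiv edges).comp (by fun_prop)).prodMk (hseed r 2)
    exact this (measurableSet_callOK E (shiftedLap G) δ.δ₁)
  have h4 : MeasurableSet {τ : RoundTape n m p E.Seed |
      ∀ r, CallOK E (shiftedLap G) (τ.1 r) δ.δ₂ (τ.2.2 r 3)} := by
    refine measurableSet_forall fun r => ?_
    have : Measurable fun τ : RoundTape n m p E.Seed => (τ.1 r, τ.2.2 r 3) :=
      Measurable.prodMk (by fun_prop) (hseed r 3)
    exact this (measurableSet_callOK E (shiftedLap G) δ.δ₂)
  have h5 : MeasurableSet {τ : RoundTape n m p E.Seed |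
      CallOK E (shiftedLap G) s δ.δ₃ (τ.2.2 ⟨p - 1, by omega⟩ 0)} :=
    (hseed _ 0) (measurableSet_callOK_seed E (shiftedLap G) s δ.δ₃)
  have h6 : MeasurableSet {τ : RoundTape n m p E.Seed |
      CallOK E (shiftedLap G) (E.run (shiftedLap G) s δ.δ₃ (τ.2.2 ⟨p - 1, by omega⟩ 0)).val δ.δ₃
        (τ.2.2 ⟨p - 1, by omega⟩ 1)} := by
    have h1 : Measurable fun ω => (E.run (shiftedLap G) s δ.δ₃ ω).val :=
      (E.measurable_val (shiftedLap G) δ.δ₃).comp measurable_prodMk_left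
    have : Measurable fun τ : RoundTape n m p E.Seed =>
        ((E.run (shiftedLap G) s δ.δ₃ (τ.2.2 ⟨p - 1, by omega⟩ 0)).val,
          τ.2.2 ⟨p - 1, by omega⟩ 1) :=
      (h1.comp (hseed _ 0)).prodMk (hseed _ 1)
    exact this (measurableSet_callOK E (shiftedLap G) δ.δ₃)
  exact h1.inter (h2.inter (h3.inter (h4.inter (h5.inter h6))))

variable {E} in
-- Each projection fails with probability at most `2/n⁴`, and `(1 - 2/n⁴)² ≥ 1 - 4/n⁴ ≥ 1 - 1/n²` as
-- `n ≥ 2`. For any fixed `P` and `Q` the calls then succeed on independent seeds.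
lemma le_measure_roundOK (κ : Sketch) (hn : 2 ≤ n) (hε : 0 < ε) (hε2 : ε ≤ 1 / 2) {η : ℕ → ℝ}
    (hE : E.Reliable η) :
    ENNReal.ofReal (1 - 1 / (n : ℝ) ^ 2) * ENNReal.ofReal (1 - η n) ^ (2 * sketchDim n ε + 2) ≤
      roundLaw E κ n m (sketchDim n ε)
        {τ | RoundOK E edges δ (sketchDim_pos hn hε) s τ} := by
  have hn2 : (2 : ℝ) ≤ n := by exact_mod_cast hn
  set x : ℝ := 2 / (n : ℝ) ^ 4 with hx
  have hx2 : 2 * x ≤ 1 / (n : ℝ) ^ 2 := by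
    rw [hx, ← mul_div_assoc, div_le_div_iff₀ (by positivity) (by positivity)]
    have h4 : (4 : ℝ) ≤ (n : ℝ) ^ 2 := by nlinarith
    nlinarith [mul_le_mul_of_nonneg_right h4 (sq_nonneg (n : ℝ))]
  have hx0 : 0 ≤ x := by positivity
  have hsq : (1 : ℝ) / (n : ℝ) ^ 2 ≤ 1 / 4 := by
    rw [div_le_div_iff₀ (by positivity) (by norm_num)]
    nlinarith
  have h1 : ENNReal.ofReal (1 - 1 / (n : ℝ) ^ 2) ≤ ENNReal.ofReal (1 - x) * ENNReal.ofReal (1 - x) := by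
    rw [← ENNReal.ofReal_mul (by linarith)]
    refine ENNReal.ofReal_le_ofReal ?_
    nlinarith
  refine (mul_le_mul_left h1 _).trans ?_
  rw [mul_assoc]
  have hm1 : ∀ {d : ℕ} (v : Fin n → Fin d → ℝ),
      MeasurableSet {P : Fin (sketchDim n ε) → Fin d → ℝ | ∀ i, SketchOK (ε / 12) P (v i)} :=
    fun v => measurableSet_forall fun i => measurableSet_sketchOK _ _
  refine (mul_le_mul_left (le_measure_sketchOK κ hn hε hε2 (omegaCol G)) _).trans
    (mul_le_measure_prod (hm1 _) fun P hP => ?_)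
  refine (mul_le_mul_left (le_measure_sketchOK κ hn hε hε2
    (fun i => edgeDiff edges (omegaCol G i))) _).trans
    (mul_le_measure_prod (hm1 _) fun Q hQ => ?_)
  refine (pow_le_measure_callsOK edges δ (sketchDim_pos hn hε) s hE P Q).trans
    (measure_mono fun σ hσ => ?_)
  exact ⟨hP, hQ, hσ⟩

end Calls

/-! ### Quadratic set functions -/

section Quadratic

variable {n : ℕ} (M : Matrix (Fin n) (Fin n) ℝ)

/-- `sᵀ M s`. -/
def quad (s : Fin n → ℝ) : ℝ := s ⬝ᵥ (M *ᵥ s)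

/-- The decrease of `sᵀ M s` when `s i` is replaced by `0`. -/
def gain (s : Fin n → ℝ) (i : Fin n) : ℝ := s i * (2 * (M *ᵥ s) i - M i i * s i)

/-- `s` with the entries in `T` replaced by `0`. -/
def zeroOn (s : Fin n → ℝ) (T : Finset (Fin n)) : Fin n → ℝ := fun i => if i ∈ T then 0 else s i

lemma zeroOn_empty (s : Fin n → ℝ) : zeroOn s ∅ = s := by
  funext i; simp [zeroOn]

lemma update_zeroOn (s : Fin n → ℝ) (T : Finset (Fin n)) (i : Fin n) :
    Function.update (zeroOn s T) i 0 = zeroOn s (insert i T) := by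
  funext j
  by_cases h : j = i
  · subst h; simp [zeroOn]
  · simp [zeroOn, h]

lemma zeroOn_nonneg {s : Fin n → ℝ} (hs : ∀ i, 0 ≤ s i) (T : Finset (Fin n)) (i : Fin n) :
    0 ≤ zeroOn s T i := by
  unfold zeroOn; split_ifs
  · exact le_rfl
  · exact hs i

lemma zeroOn_antitone {s : Fin n → ℝ} (hs : ∀ i, 0 ≤ s i) {T U : Finset (Fin n)} (h : T ⊆ U)
    (i : Fin n) : zeroOn s U i ≤ zeroOn s T i := by
  unfold zeroOn
  by_cases hi : i ∈ T
  · simp [hi, h hi]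
  · simp only [hi, if_false]
    split_ifs
    · exact hs i
    · exact le_rfl

variable {M}

lemma quad_sub_quad_update (hM : ∀ i j, M i j = M j i) (s : Fin n → ℝ) (i : Fin n) :
    quad M s - quad M (Function.update s i 0) = gain M s i := by
  have h1 : Function.update s i 0 = s - Pi.single i (s i) := by
    funext j
    by_cases h : j = i
    · subst h; simp
    · simp [h]
  have h2 : (s ᵥ* M) i = (M *ᵥ s) i := by
    simp only [Matrix.mulVec, Matrix.vecMul, dotProduct]
    exact Finset.sum_congr rfl fun j _ => by rw [hM j i, mul_comm]
  have h3 : (M *ᵥ Pi.single i (s i)) i = M i i * s i := dotProduct_single _ _ _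
  have h4 : s ⬝ᵥ (M *ᵥ Pi.single i (s i)) = (M *ᵥ s) i * s i := by
    rw [Matrix.dotProduct_mulVec, dotProduct_single, h2]
  simp only [quad, gain, h1, Matrix.mulVec_sub, sub_dotProduct, dotProduct_sub,
    single_dotProduct, h3, h4]
  ring

/-- Besides making gains nonnegative, this prevents cancellation when the gains are estimated. -/
lemma diag_mul_le_mulVec (hM0 : ∀ i j, 0 ≤ M i j) {s : Fin n → ℝ} (hs : ∀ i, 0 ≤ s i)
    (i : Fin n) : M i i * s i ≤ (M *ᵥ s) i :=
  Finset.single_le_sum (f := fun j => M i j * s j) (fun j _ => mul_nonneg (hM0 i j) (hs j))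
    (Finset.mem_univ i)

lemma gain_nonneg (hM0 : ∀ i j, 0 ≤ M i j) {s : Fin n → ℝ} (hs : ∀ i, 0 ≤ s i) (i : Fin n) :
    0 ≤ gain M s i := by
  have h1 := diag_mul_le_mulVec hM0 hs i
  have h2 := mul_nonneg (hM0 i i) (hs i)
  exact mul_nonneg (hs i) (by linarith)

/-- This is supermodularity: for fixed `s i` the gain depends on the other entries only through `(M
s)_i`, which is monotone as `M ≥ 0`. -/
lemma gain_mono (hM0 : ∀ i j, 0 ≤ M i j) {s s' : Fin n → ℝ} (hs : ∀ i, 0 ≤ s' i)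
    (h : ∀ j, s' j ≤ s j) {i : Fin n} (hi : s' i = s i) : gain M s' i ≤ gain M s i := by
  have h1 : (M *ᵥ s') i ≤ (M *ᵥ s) i := by
    change ∑ j, M i j * s' j ≤ ∑ j, M i j * s j
    exact Finset.sum_le_sum fun j _ => mul_le_mul_of_nonneg_left (h j) (hM0 i j)
  unfold gain
  rw [hi]
  refine mul_le_mul_of_nonneg_left ?_ (hi ▸ hs i)
  linarith

lemma quad_zeroOn_insert (hM : ∀ i j, M i j = M j i) (s : Fin n → ℝ) (T : Finset (Fin n)) (i : Fin n) :
    quad M (zeroOn s T) - quad M (zeroOn s (insert i T)) = gain M (zeroOn s T) i := by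
  rw [← update_zeroOn, quad_sub_quad_update hM]

/-- `T ↦ sᵀ M s` with the entries in `T` replaced by `0` is decreasing and supermodular. -/
lemma quad_zeroOn_union (hM : ∀ i j, M i j = M j i) (hM0 : ∀ i j, 0 ≤ M i j) {s : Fin n → ℝ}
    (hs : ∀ i, 0 ≤ s i) (T A : Finset (Fin n)) :
    quad M (zeroOn s (T ∪ A)) ≤ quad M (zeroOn s T) ∧
      quad M (zeroOn s T) - quad M (zeroOn s (T ∪ A)) ≤ ∑ i ∈ A \ T, gain M (zeroOn s T) i := by
  induction A using Finset.induction_on with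
  | empty => simp
  | insert a A ha ih =>
    by_cases haT : a ∈ T
    · have h1 : T ∪ insert a A = T ∪ A := by
        ext x; simp only [Finset.mem_union, Finset.mem_insert]; grind
      have h2 : insert a A \ T = A \ T := Finset.insert_sdiff_of_mem _ haT
      rw [h1, h2]
      exact ih
    · have h1 : T ∪ insert a A = insert a (T ∪ A) := Finset.union_insert a T A
      have h2 : insert a A \ T = insert a (A \ T) := Finset.insert_sdiff_of_notMem _ haT
      have h3 := quad_zeroOn_insert hM s (T ∪ A) a
      have h4 := gain_nonneg hM0 (zeroOn_nonneg hs (T ∪ A)) a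
      have h5 : gain M (zeroOn s (T ∪ A)) a ≤ gain M (zeroOn s T) a := by
        refine gain_mono hM0 (zeroOn_nonneg hs _)
          (zeroOn_antitone hs Finset.subset_union_left) ?_
        simp [zeroOn, haT, ha]
      rw [h1, h2, Finset.sum_insert (by simp [ha])]
      constructor <;> linarith [ih.1, ih.2]

/-- One greedy step with an approximately maximal gain. -/
lemma greedy_progress (hM : ∀ i j, M i j = M j i) (hM0 : ∀ i j, 0 ≤ M i j) {s : Fin n → ℝ}
    (hs : ∀ i, 0 ≤ s i) {k : ℕ} (hk : 0 < k) {ε : ℝ} {Topt T : Finset (Fin n)}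
    (hcard : Topt.card = k) {i : Fin n} (hε : ε ≤ 1)
    (hi : ∀ j, j ∉ T → (1 - ε) * gain M (zeroOn s T) j ≤ gain M (zeroOn s T) i) :
    quad M (zeroOn s (insert i T)) - quad M (zeroOn s Topt) ≤
      (1 - (1 - ε) / k) * (quad M (zeroOn s T) - quad M (zeroOn s Topt)) := by
  have hk' : (0 : ℝ) < k := by exact_mod_cast hk
  -- `f T - f Topt ≤ f T - f (T ∪ Topt)`, which is at most the sum of the gains over `Topt \ T`;
  -- these are at most `k` nodes.
  have h1 := (quad_zeroOn_union hM hM0 hs T Topt).2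
  have h2 := (quad_zeroOn_union hM hM0 hs Topt T).1
  rw [Finset.union_comm] at h2
  have h3 := quad_zeroOn_insert hM s T i
  have h4 := gain_nonneg hM0 (zeroOn_nonneg hs T) i
  have h5 : (1 - ε) * ∑ j ∈ Topt \ T, gain M (zeroOn s T) j ≤ k * gain M (zeroOn s T) i := by
    rw [Finset.mul_sum]
    calc ∑ j ∈ Topt \ T, (1 - ε) * gain M (zeroOn s T) j
        ≤ ∑ _j ∈ Topt \ T, gain M (zeroOn s T) i :=
          Finset.sum_le_sum fun j hj => hi j (Finset.mem_sdiff.mp hj).2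
      _ = ((Topt \ T).card : ℝ) * gain M (zeroOn s T) i := by
          rw [Finset.sum_const, nsmul_eq_mul]
      _ ≤ k * gain M (zeroOn s T) i := by
          refine mul_le_mul_of_nonneg_right ?_ h4
          rw [← hcard]
          exact_mod_cast Finset.card_le_card Finset.sdiff_subset
  have h6 : (1 - ε) * (quad M (zeroOn s T) - quad M (zeroOn s Topt)) ≤
      k * gain M (zeroOn s T) i :=
    (mul_le_mul_of_nonneg_left (by linarith) (by linarith)).trans h5
  have h7 : (1 - ε) / k * (quad M (zeroOn s T) - quad M (zeroOn s Topt)) ≤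
      gain M (zeroOn s T) i := by
    rw [div_mul_eq_mul_div, div_le_iff₀ hk']
    linarith
  linarith

end Quadratic

/-- The final factor of the greedy algorithm. -/
lemma greedy_factor_le {k : ℕ} (hk : 0 < k) {ε : ℝ} (h0 : 0 ≤ ε) (h1 : ε ≤ 1 / 2) :
    (1 - (1 - ε) / k) ^ k ≤ 1 / Real.exp 1 + ε := by
  have hk' : (1 : ℝ) ≤ k := by exact_mod_cast hk
  have h2 : (1 - ε) / k ≤ 1 := by
    rw [div_le_one (by linarith)]; linarith
  calc (1 - (1 - ε) / k) ^ k ≤ Real.exp (-((1 - ε) / k)) ^ k := by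
        refine pow_le_pow_left₀ (by linarith) ?_ k
        linarith [Real.add_one_le_exp (-((1 - ε) / k))]
    _ = Real.exp ε / Real.exp 1 := by
        rw [← Real.exp_nat_mul, ← Real.exp_sub]
        congr 1
        field_simp
        ring
    _ ≤ 1 / Real.exp 1 + ε := by
        have h3 : Real.exp ε ≤ 1 + ε + ε ^ 2 := by
          have := Real.abs_exp_sub_one_sub_id_le (x := ε) (by rw [abs_of_nonneg h0]; linarith)
          linarith [(abs_le.mp this).2]
        have h4 : (2 : ℝ) ≤ Real.exp 1 := by linarith [Real.add_one_le_exp (1 : ℝ)]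
        rw [div_add' _ _ _ (Real.exp_pos 1).ne', div_le_div_iff_of_pos_right (Real.exp_pos 1)]
        nlinarith

/-! ### The conflict measures as quadratic forms -/

section Conflict

variable {n m : ℕ} (G : SimpleGraph (Fin n)) [DecidableRel G.Adj] (o : Objective)

/-- The matrix of a conflict measure: `Ω` or `Ω²`. -/
def conflictMatrix : Matrix (Fin n) (Fin n) ℝ :=
  match o with
  | .resistance => (shiftedLap G)⁻¹
  | .controversy => (shiftedLap G)⁻¹ * (shiftedLap G)⁻¹

lemma conflictMatrix_symm (i j : Fin n) : conflictMatrix G o i j = conflictMatrix G o j i := by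
  cases o with
  | resistance => exact omega_symm G i j
  | controversy =>
    simp only [conflictMatrix, Matrix.mul_apply]
    exact Finset.sum_congr rfl fun l _ => by
      rw [omega_symm G i l, omega_symm G l j, mul_comm]

lemma conflictMatrix_nonneg (i j : Fin n) : 0 ≤ conflictMatrix G o i j := by
  cases o with
  | resistance => exact omega_nonneg G i j
  | controversy =>
    simp only [conflictMatrix, Matrix.mul_apply]
    exact Finset.sum_nonneg fun l _ => mul_nonneg (omega_nonneg G i l) (omega_nonneg G l j)

lemma conflict_eq_quad (s : Fin n → ℝ) : conflict G o s = quad (conflictMatrix G o) s := by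
  cases o with
  | resistance => rfl
  | controversy =>
    simp only [conflict, quad, conflictMatrix, equilibrium]
    -- `(Ωs)ᵀ(Ωs) = sᵀΩ²s`, because `Ωᵀ = Ω`.
    rw [← Matrix.mulVec_mulVec, Matrix.dotProduct_mulVec s, ← Matrix.mulVec_transpose]
    congr 2
    ext i j
    exact omega_symm G i j

lemma objective_eq_quad (s : Fin n → ℝ) (T : Finset (Fin n)) :
    objective G o s T = quad (conflictMatrix G o) (zeroOn s T) :=
  conflict_eq_quad G o _

end Conflict

/-! ### Accuracy of the estimated gains -/

section Accuracy

variable {n m : ℕ} {G : SimpleGraph (Fin n)} [DecidableRel G.Adj] {ε : ℝ}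

/-- The squared norm is `bᵀ Ω b`, and the entries of `Ω` are at most `1`. -/
lemma energyNorm_equilibrium_le {b : Fin n → ℝ} (hb : ∀ i, 0 ≤ b i) :
    energyNorm (shiftedLap G) (equilibrium G b) ≤ ∑ i, b i := by
  have hsum : 0 ≤ ∑ i, b i := Finset.sum_nonneg fun i _ => hb i
  refine abs_le_of_sq_le_sq' ?_ hsum |>.2
  rw [sq_energyNorm, shiftedLap_mulVec_equilibrium]
  have h1 : ∀ i, equilibrium G b i ≤ ∑ j, b j := by
    intro i
    rw [equilibrium_apply]
    exact Finset.sum_le_sum fun j _ => mul_le_of_le_one_right (hb j) (omega_le_one G j i)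
  rw [pow_two, Finset.mul_sum]
  exact Finset.sum_le_sum fun i _ => mul_le_mul_of_nonneg_right (h1 i) (hb i)

lemma sum_le_det_mul_equilibrium (hG : G.Connected) {b : Fin n → ℝ} (hb : ∀ i, 0 ≤ b i)
    (i : Fin n) : ∑ j, b j ≤ (shiftedLap G).det * equilibrium G b i := by
  rw [equilibrium_apply, dotProduct, Finset.mul_sum]
  refine Finset.sum_le_sum fun j _ => ?_
  have := mul_le_mul_of_nonneg_left (one_le_det_mul_omega hG j i) (hb j)
  rw [mul_one] at this
  refine this.trans (le_of_eq ?_)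
  simp only [omegaCol]
  ring

/-- A call with the parameter `δ₃` and a nonnegative right-hand side has a small relative error in
every entry. -/
lemma abs_sub_equilibrium_le (hn : 2 ≤ n) (hG : G.Connected) (hε : 0 < ε) {δ : ℝ} (hδ : 0 < δ)
    (hδ3 : δ ≤ delta₃Bound G ε) {b y : Fin n → ℝ} (hb : ∀ i, 0 ≤ b i)
    (hy : energyNorm (shiftedLap G) (y - equilibrium G b) ≤
      δ * energyNorm (shiftedLap G) (equilibrium G b)) (i : Fin n) :
    |y i - equilibrium G b i| ≤ ε / 12 * equilibrium G b i := by
  have hd := det_shiftedLap_pos G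
  have h1 := abs_apply_le_energyNorm (G := G) (y - equilibrium G b) i
  have h2 := mul_le_mul_of_nonneg_left (energyNorm_equilibrium_le (G := G) hb) hδ.le
  have h3 := mul_le_mul_of_nonneg_left (sum_le_det_mul_equilibrium hG hb i) hδ.le
  have hq := equilibrium_nonneg (G := G) hb i
  have hn2 : (2 : ℝ) ≤ n := by exact_mod_cast hn
  -- All that is needed of this factor of `δ₃` is that it improves `ε/6` to `ε/12`.
  have hsqrt : (2 : ℝ) ≤ √(n * (1 + n)) := by
    refine Real.le_sqrt_of_sq_le ?_
    nlinarith
  have h4 : δ * (shiftedLap G).det ≤ ε / 12 := by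
    refine (mul_le_mul_of_nonneg_right hδ3 hd.le).trans ?_
    unfold delta₃Bound
    rw [div_mul_eq_mul_div, div_le_div_iff₀ (by positivity) (by norm_num)]
    have := mul_le_mul_of_nonneg_left hsqrt (by positivity : 0 ≤ ε * (6 * (shiftedLap G).det))
    linarith
  have h5 := mul_le_mul_of_nonneg_right h4 hq
  rw [Pi.sub_apply] at h1
  linarith

/-- The bounds differ by the factor `(n - 1)/n² ≤ 1`, so the error analysis of `Ỹ` also covers `X̃`.
-/
lemma delta₁Bound_le (hn : 2 ≤ n) (hε : 0 < ε) : delta₁Bound n ε ≤ delta₂Bound n ε := by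
  have hn2 : (2 : ℝ) ≤ n := by exact_mod_cast hn
  unfold delta₁Bound delta₂Bound
  have h1 : ε * √(1 - ε / 12) * ((n : ℝ) - 1) /
      (32 * n ^ 2 * (n + 1) * √((1 + ε / 12) * (n + 1) * n)) =
      ε * √(1 - ε / 12) / (32 * (n + 1) * √((1 + ε / 12) * (n + 1) * n)) *
        (((n : ℝ) - 1) / n ^ 2) := by
    field_simp
  rw [h1]
  refine mul_le_of_le_one_right (by positivity) ?_
  rw [div_le_one (by positivity)]
  nlinarith

/-- The factor `(1 + ε/12)(n + 1)n` comes from `I + L ≼ (n+1) I` and from `n` projected columns of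
squared norm at most `1 + ε/12`. -/
lemma sq_delta₂Bound_mul_le (hn : 2 ≤ n) (hε : 0 < ε) (hε2 : ε ≤ 1 / 2) :
    delta₂Bound n ε ^ 2 * ((1 + ε / 12) * (n + 1) * n) ≤ (ε / 32 * (1 / ((n : ℝ) + 1))) ^ 2 := by
  have hn2 : (2 : ℝ) ≤ n := by exact_mod_cast hn
  unfold delta₂Bound
  rw [div_pow, mul_pow, mul_pow, Real.sq_sqrt (by linarith), Real.sq_sqrt (by positivity)]
  have h1 : ε ^ 2 * (1 - ε / 12) / ((32 * ((n : ℝ) + 1)) ^ 2 * ((1 + ε / 12) * (n + 1) * n)) *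
      ((1 + ε / 12) * (n + 1) * n) = (ε / 32 * (1 / ((n : ℝ) + 1))) ^ 2 * (1 - ε / 12) := by
    have : (1 + ε / 12 : ℝ) ≠ 0 := by positivity
    field_simp
  rw [h1]
  exact mul_le_of_le_one_right (by positivity) (by linarith)

/-- The columns of the matrix of approximate solutions are close to the exact ones. -/
lemma sum_sq_error_le (hn : 2 ≤ n) (hε : 0 < ε) (hε2 : ε ≤ 1 / 2) {δ : ℝ} (hδ : 0 < δ)
    (hδ2 : δ ≤ delta₂Bound n ε) {p : ℕ} {b y : Fin p → Fin n → ℝ}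
    (hy : ∀ r, energyNorm (shiftedLap G) (y r - equilibrium G (b r)) ≤
      δ * energyNorm (shiftedLap G) (equilibrium G (b r))) {w : Fin n → ℝ} (hw : ∀ i, w i ≤ 1)
    (hs : ∀ i, ∑ r, equilibrium G (b r) i ^ 2 ≤ (1 + ε / 12) * w i) (i : Fin n) :
    ∑ r, (y r i - equilibrium G (b r) i) ^ 2 ≤ (ε / 32 * (1 / ((n : ℝ) + 1))) ^ 2 := by
  calc ∑ r, (y r i - equilibrium G (b r) i) ^ 2
      ≤ ∑ r, δ ^ 2 * ((n + 1) * (equilibrium G (b r) ⬝ᵥ equilibrium G (b r))) := by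
        refine Finset.sum_le_sum fun r _ => ?_
        have h1 := abs_apply_le_energyNorm (G := G) (y r - equilibrium G (b r)) i
        have h2 := pow_le_pow_left₀ (abs_nonneg _) (h1.trans (hy r)) 2
        rw [sq_abs, mul_pow, sq_energyNorm] at h2
        exact h2.trans (mul_le_mul_of_nonneg_left (energy_le _) (sq_nonneg δ))
    _ = δ ^ 2 * ((n + 1) * ∑ j, ∑ r, equilibrium G (b r) j ^ 2) := by
        rw [← Finset.mul_sum, ← Finset.mul_sum, Finset.sum_comm]
        simp only [dotProduct, pow_two]
    _ ≤ delta₂Bound n ε ^ 2 * ((n + 1) * ∑ _j : Fin n, (1 + ε / 12)) := by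
        refine mul_le_mul (pow_le_pow_left₀ hδ.le hδ2 2) ?_ ?_ (sq_nonneg _)
        · refine mul_le_mul_of_nonneg_left (Finset.sum_le_sum fun j _ => ?_) (by positivity)
          refine (hs j).trans (mul_le_of_le_one_right (by positivity) (hw j))
        · exact mul_nonneg (by positivity)
            (Finset.sum_nonneg fun j _ => Finset.sum_nonneg fun r _ => sq_nonneg _)
    _ = delta₂Bound n ε ^ 2 * ((1 + ε / 12) * (n + 1) * n) := by
        rw [Finset.sum_const, Finset.card_univ, Fintype.card_fin, nsmul_eq_mul]
        ring
    _ ≤ _ := sq_delta₂Bound_mul_le hn hε hε2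

/-- Perturbation of a sum of squares. -/
lemma abs_sum_sq_sub_le {p : ℕ} {x y : Fin p → ℝ} {a d : ℝ} (hε : 0 < ε) (hε2 : ε ≤ 1 / 2)
    (hx : ∑ r, x r ^ 2 ≤ (1 + ε / 12) * a ^ 2)
    (hd : ∑ r, (y r - x r) ^ 2 ≤ d ^ 2) (hd0 : 0 ≤ d) (hda : d ≤ ε / 32 * a) :
    |∑ r, y r ^ 2 - ∑ r, x r ^ 2| ≤ ε / 14 * a ^ 2 := by
  have h1 : ∑ r, y r ^ 2 - ∑ r, x r ^ 2 =
      2 * ∑ r, x r * (y r - x r) + ∑ r, (y r - x r) ^ 2 := by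
    rw [Finset.mul_sum, ← Finset.sum_add_distrib, ← Finset.sum_sub_distrib]
    exact Finset.sum_congr rfl fun r _ => by ring
  have hd2 : ∑ r, (y r - x r) ^ 2 ≤ (ε / 32 * a) ^ 2 :=
    hd.trans (pow_le_pow_left₀ hd0 hda 2)
  -- Cauchy–Schwarz; `103/100` majorizes `√(1 + ε/12)` for `ε ≤ 1/2`.
  have h2 : |∑ r, x r * (y r - x r)| ≤ 103 / 100 * (ε / 32) * a ^ 2 := by
    refine abs_le_of_sq_le_sq ?_ (by positivity)
    refine (Finset.sum_mul_sq_le_sq_mul_sq _ _ _).trans ?_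
    calc (∑ r, x r ^ 2) * ∑ r, (y r - x r) ^ 2
        ≤ ((1 + ε / 12) * a ^ 2) * (ε / 32 * a) ^ 2 :=
          mul_le_mul hx hd2 (Finset.sum_nonneg fun r _ => sq_nonneg _) (by positivity)
      _ = (1 + ε / 12) * (ε / 32 * a ^ 2) ^ 2 := by ring
      _ ≤ (103 / 100) ^ 2 * (ε / 32 * a ^ 2) ^ 2 := by
          refine mul_le_mul_of_nonneg_right (by linarith) (sq_nonneg _)
      _ = _ := by ring
  have h3 : 0 ≤ ∑ r, (y r - x r) ^ 2 := Finset.sum_nonneg fun r _ => sq_nonneg _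
  have h4 : (ε / 32 * a) ^ 2 ≤ ε / 2048 * a ^ 2 := by
    have : ε ^ 2 ≤ ε / 2 := by nlinarith
    nlinarith [mul_le_mul_of_nonneg_right this (sq_nonneg a)]
  have h5 : 0 ≤ ε * a ^ 2 := by positivity
  rw [h1]
  rw [abs_le] at h2 ⊢
  constructor <;> nlinarith [h2.1, h2.2]

/-- Relative error of the gain formula. -/
lemma abs_gain_error_le {σ q q' D D' c c' : ℝ} (hσ : 0 ≤ σ) (hD : 0 ≤ D) (hq : D * σ ≤ q)
    (hc : 0 ≤ c') (h1 : |q' - q| ≤ c * q) (h2 : |D' - D| ≤ c' * D) (hcc : 2 * c + c' ≤ ε / 2)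
    (hε : 0 ≤ ε) :
    |σ * (2 * q' - D' * σ) - σ * (2 * q - D * σ)| ≤ ε / 2 * (σ * (2 * q - D * σ)) := by
  have e : σ * (2 * q' - D' * σ) - σ * (2 * q - D * σ) =
      σ * (2 * (q' - q) - (D' - D) * σ) := by ring
  rw [e, abs_mul, abs_of_nonneg hσ]
  have h3 : |2 * (q' - q) - (D' - D) * σ| ≤ 2 * (c * q) + c' * D * σ := by
    refine (abs_sub _ _).trans (add_le_add ?_ ?_)
    · rw [abs_mul, abs_two]; linarith
    · rw [abs_mul, abs_of_nonneg hσ]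
      exact mul_le_mul_of_nonneg_right h2 hσ
  have hq0 : 0 ≤ q := (mul_nonneg hD hσ).trans hq
  -- Since `D σ ≤ q`, the error is at most `(2c + c') q`, while `2q - D σ ≥ q`.
  have h4 : 2 * (c * q) + c' * D * σ ≤ ε / 2 * (2 * q - D * σ) := by
    have h5 := mul_le_mul_of_nonneg_left hq hc
    have h6 := mul_le_mul_of_nonneg_right hcc hq0
    have h7 : ε / 2 * q ≤ ε / 2 * (2 * q - D * σ) :=
      mul_le_mul_of_nonneg_left (by linarith) (by linarith)
    linarith
  calc σ * |2 * (q' - q) - (D' - D) * σ| ≤ σ * (ε / 2 * (2 * q - D * σ)) :=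
        mul_le_mul_of_nonneg_left (h3.trans h4) hσ
    _ = _ := by ring

variable (E : Estimator.{u}) (o : Objective) (edges : EdgeList G m) (δ : Precision G ε)
  {p : ℕ} (hp : 0 < p)

/-- In a successful round all gains are estimated up to the factor `1 ± ε / 2`. -/
lemma abs_estimateDelta_sub_gain_le (hn : 2 ≤ n) (hG : G.Connected) (hε : 0 < ε)
    (hε2 : ε ≤ 1 / 2) {s : Fin n → ℝ} (hs : ∀ i, 0 ≤ s i) {τ : RoundTape n m p E.Seed}
    (hτ : RoundOK E edges δ hp s τ) (i : Fin n) :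
    |(estimateDelta E o edges δ p s τ).val i - gain (conflictMatrix G o) s i| ≤
      ε / 2 * gain (conflictMatrix G o) s i := by
  obtain ⟨hP, hQ, hX, hY, hq, hh⟩ := hτ
  have hn2 : (2 : ℝ) ≤ n := by exact_mod_cast hn
  set Y := omegaCol G i ⬝ᵥ omegaCol G i with hYdef
  set W := edgeDiff edges (omegaCol G i) ⬝ᵥ edgeDiff edges (omegaCol G i) with hWdef
  set D := (shiftedLap G)⁻¹ i i with hDdef
  have hYnn : ∀ j, 0 ≤ omegaCol G j ⬝ᵥ omegaCol G j := fun j => dotProduct_self_nonneg' _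
  have hWnn : ∀ j, 0 ≤ edgeDiff edges (omegaCol G j) ⬝ᵥ edgeDiff edges (omegaCol G j) :=
    fun j => dotProduct_self_nonneg' _
  have hDW : D = W + Y := omega_diag_eq edges i
  have hY1 : ∀ j, omegaCol G j ⬝ᵥ omegaCol G j ≤ 1 := fun j => by
    linarith [omega_diag_eq edges j, omega_le_one G j j, hWnn j]
  have hW1 : ∀ j, edgeDiff edges (omegaCol G j) ⬝ᵥ edgeDiff edges (omegaCol G j) ≤ 1 := fun j => by
    linarith [omega_diag_eq edges j, omega_le_one G j j, hYnn j]
  have hD1 : D ≤ 1 := omega_le_one G i i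
  have hDn : 1 / ((n : ℝ) + 1) ≤ D := omega_diag_ge G i
  have hD0 : 0 < D := lt_of_lt_of_le (by positivity) hDn
  have hd0 : 0 ≤ ε / 32 * (1 / ((n : ℝ) + 1)) := by positivity
  have hPe : ∀ j r, equilibrium G (τ.1 r) j = τ.1 r ⬝ᵥ omegaCol G j :=
    fun j r => equilibrium_apply _ _
  have hQe : ∀ j r, equilibrium G (edgeDiv edges (τ.2.1 r)) j =
      τ.2.1 r ⬝ᵥ edgeDiff edges (omegaCol G j) := fun j r => by
    rw [equilibrium_apply, edgeDiv_dotProduct]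
  have hP' : ∀ j, |∑ r, equilibrium G (τ.1 r) j ^ 2 - omegaCol G j ⬝ᵥ omegaCol G j| ≤
      ε / 12 * (omegaCol G j ⬝ᵥ omegaCol G j) := fun j => by
    simp only [hPe]; exact hP j
  have hQ' : ∀ j, |∑ r, equilibrium G (edgeDiv edges (τ.2.1 r)) j ^ 2 -
      edgeDiff edges (omegaCol G j) ⬝ᵥ edgeDiff edges (omegaCol G j)| ≤
      ε / 12 * (edgeDiff edges (omegaCol G j) ⬝ᵥ edgeDiff edges (omegaCol G j)) := fun j => by
    simp only [hQe]; exact hQ j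
  have hPu : ∀ j, ∑ r, equilibrium G (τ.1 r) j ^ 2 ≤
      (1 + ε / 12) * (omegaCol G j ⬝ᵥ omegaCol G j) := fun j => by
    linarith [(abs_le.mp (hP' j)).2]
  have hQu : ∀ j, ∑ r, equilibrium G (edgeDiv edges (τ.2.1 r)) j ^ 2 ≤
      (1 + ε / 12) * (edgeDiff edges (omegaCol G j) ⬝ᵥ edgeDiff edges (omegaCol G j)) :=
    fun j => by linarith [(abs_le.mp (hQ' j)).2]
  have eY := sum_sq_error_le (G := G) hn hε hε2 δ.pos₂ δ.le₂ hY hY1 hPu i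
  have eX := sum_sq_error_le (G := G) hn hε hε2 δ.pos₁
    (δ.le₁.trans (delta₁Bound_le hn hε)) hX hW1 hQu i
  have eq1 := abs_sub_equilibrium_le hn hG hε δ.pos₃ δ.le₃ hs hq
  set q := (E.run (shiftedLap G) s δ.δ₃ (τ.2.2 ⟨p - 1, by omega⟩ 0)).val with hqdef
  have hqnn : ∀ j, 0 ≤ q j := fun j => by
    have h1 := (abs_le.mp (eq1 j)).1
    have h2 := equilibrium_nonneg (G := G) hs j
    nlinarith
  have eh1 := abs_sub_equilibrium_le hn hG hε δ.pos₃ δ.le₃ hqnn hh i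
  set h := (E.run (shiftedLap G) q δ.δ₃ (τ.2.2 ⟨p - 1, by omega⟩ 1)).val with hhdef
  rw [val_estimateDelta E o edges δ s τ hp]
  have hsqY : √Y ^ 2 = Y := Real.sq_sqrt (hYnn i)
  have hDY : D ≤ √Y := Real.le_sqrt_of_sq_le (sq_omega_diag_le i)
  have aY := abs_sum_sq_sub_le (a := √Y) hε hε2
    (by rw [hsqY]; exact hPu i) eY hd0
    (mul_le_mul_of_nonneg_left (hDn.trans hDY) (by positivity))
  rw [hsqY] at aY
  have pY : |∑ r, equilibrium G (τ.1 r) i ^ 2 - Y| ≤ ε / 12 * Y := hP' i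
  cases o with
  | resistance =>
    have hsqD : √D ^ 2 = D := Real.sq_sqrt hD0.le
    -- `‖BΩe_i‖²` comes with no lower bound of its own, so the error in `X̃` is measured against
    -- `Ω_ii`, which dominates it. Here `D ≤ √D` because `D ≤ 1`.
    have hDD : D ≤ √D := Real.le_sqrt_of_sq_le (by nlinarith)
    have aX := abs_sum_sq_sub_le (a := √D) hε hε2
      (by
        rw [hsqD]
        refine (hQu i).trans (mul_le_mul_of_nonneg_left ?_ (by positivity))
        linarith [hYnn i])
      eX hd0 (mul_le_mul_of_nonneg_left (hDn.trans hDD) (by positivity))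
    rw [hsqD] at aX
    have pX : |∑ r, equilibrium G (edgeDiv edges (τ.2.1 r)) i ^ 2 - W| ≤ ε / 12 * W := hQ' i
    refine abs_gain_error_le (c := ε / 12) (c' := ε / 12 + ε / 14 + ε / 14) (hs i) hD0.le
      (diag_mul_le_mulVec (omega_nonneg G) hs i) (by positivity) (eq1 i) ?_ (by linarith) hε.le
    change |(∑ r, (E.run (shiftedLap G) (edgeDiv edges (τ.2.1 r)) δ.δ₁ (τ.2.2 r 2)).val i ^ 2 +
      ∑ r, (E.run (shiftedLap G) (τ.1 r) δ.δ₂ (τ.2.2 r 3)).val i ^ 2) - D| ≤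
      (ε / 12 + ε / 14 + ε / 14) * D
    have hYD : ε / 14 * Y ≤ ε / 14 * D :=
      mul_le_mul_of_nonneg_left (by linarith [hWnn i]) (by positivity)
    have hsplit : ε / 12 * D = ε / 12 * W + ε / 12 * Y := by rw [hDW]; ring
    rw [abs_le] at aX aY pX pY ⊢
    constructor <;> linarith [aX.1, aX.2, aY.1, aY.2, pX.1, pX.2, pY.1, pY.2]
  | controversy =>
    have hYd : (conflictMatrix G .controversy) i i = Y := by
      simp only [conflictMatrix, Matrix.mul_apply, hYdef, dotProduct, omegaCol]
      exact Finset.sum_congr rfl fun j _ => by rw [omega_symm G i j]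
    have hHe : (conflictMatrix G .controversy *ᵥ s) i =
        equilibrium G (equilibrium G s) i := by
      simp only [conflictMatrix, equilibrium, Matrix.mulVec_mulVec]
    have hH0 : 0 ≤ equilibrium G (equilibrium G s) i :=
      equilibrium_nonneg (equilibrium_nonneg hs) i
    have hdiag : Y * s i ≤ equilibrium G (equilibrium G s) i := by
      rw [← hYd, ← hHe]
      exact diag_mul_le_mulVec (conflictMatrix_nonneg G .controversy) hs i
    -- Applying the nonnegative matrix `Ω` preserves the entrywise relative error of `q`.
    have eh2 : |equilibrium G q i - equilibrium G (equilibrium G s) i| ≤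
        ε / 12 * equilibrium G (equilibrium G s) i := by
      simp only [equilibrium_apply (G := G) q, equilibrium_apply (G := G) (equilibrium G s),
        dotProduct]
      rw [← Finset.sum_sub_distrib, Finset.mul_sum]
      refine (Finset.abs_sum_le_sum_abs _ _).trans (Finset.sum_le_sum fun j _ => ?_)
      have hω : 0 ≤ omegaCol G i j := omega_nonneg G j i
      rw [← sub_mul, abs_mul, abs_of_nonneg hω, ← mul_assoc]
      exact mul_le_mul_of_nonneg_right (eq1 j) hω
    have key := abs_gain_error_le (σ := s i) (q := equilibrium G (equilibrium G s) i) (q' := h i)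
      (D := Y) (D' := ∑ r, (E.run (shiftedLap G) (τ.1 r) δ.δ₂ (τ.2.2 r 3)).val i ^ 2)
      -- The two nested solves give `(1 + ε/12)² - 1 = ε/6 + ε²/144`, and `ε ≤ 1/2`.
      (c := ε / 6 + ε / 288) (c' := ε / 12 + ε / 14) (ε := ε) (hs i) (hYnn i) hdiag
      (by positivity) ?_ ?_ (by linarith) hε.le
    · unfold gain
      rw [hYd, hHe]
      exact key
    · have h3 : ε / 12 * equilibrium G q i ≤
          ε / 12 * ((1 + ε / 12) * equilibrium G (equilibrium G s) i) :=
        mul_le_mul_of_nonneg_left (by linarith [(abs_le.mp eh2).2]) (by positivity)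
      have h4 : ε ^ 2 * equilibrium G (equilibrium G s) i ≤
          ε / 2 * equilibrium G (equilibrium G s) i :=
        mul_le_mul_of_nonneg_right (by nlinarith) hH0
      rw [abs_le] at eh1 eh2 ⊢
      constructor <;> nlinarith [eh1.1, eh1.2, eh2.1, eh2.2]
    · rw [abs_le] at aY pY ⊢
      constructor <;> linarith [aY.1, aY.2, pY.1, pY.2]

end Accuracy

/-! ### Greedy-AC as a sequence of rounds -/

section Main

variable {n m : ℕ} {G : SimpleGraph (Fin n)} [DecidableRel G.Adj] {ε : ℝ} (E : Estimator.{u})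
  (κ : Sketch) (o : Objective) (tie : Finset (Fin n) → Fin n → Fin n → Bool)
  (edges : EdgeList G m) (δ : Precision G ε)

/-- One round of Greedy-AC. -/
def roundStep (ω : RoundTape n m (sketchDim n ε) E.Seed) (st : Finset (Fin n) × (Fin n → ℝ)) :
    Timed (Finset (Fin n) × (Fin n → ℝ)) := do
  let (T, s) := st
  let d ← estimateDelta E o edges δ (sketchDim n ε) s ω
  let best ← argmaxOutside tie T d
  match best with
  | none => pure (T, s)
  | some i => do
    let T ← Timed.op (insert i T)
    let s ← Timed.op (Function.update s i 0)
    pure (T, s)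

lemma val_greedyAC (s : Fin n → ℝ) (k : ℕ)
    (τ : Fin k → RoundTape n m (sketchDim n ε) E.Seed) :
    (greedyAC E o tie edges δ s k τ).val =
      (Timed.loop k (fun t => roundStep E o tie edges δ (τ t)) (∅, s)).val.1 := rfl

lemma steps_greedyAC (s : Fin n → ℝ) (k : ℕ)
    (τ : Fin k → RoundTape n m (sketchDim n ε) E.Seed) :
    (greedyAC E o tie edges δ s k τ).steps =
      2 * n + (Timed.loop k (fun t => roundStep E o tie edges δ (τ t)) (∅, s)).steps := rfl

lemma val_roundStep (ω : RoundTape n m (sketchDim n ε) E.Seed) (T : Finset (Fin n))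
    (s : Fin n → ℝ) {i : Fin n}
    (h : (argmaxOutside tie T (estimateDelta E o edges δ (sketchDim n ε) s ω).val).val = some i) :
    (roundStep E o tie edges δ ω (T, s)).val = (insert i T, Function.update s i 0) := by
  simp only [roundStep, Timed.val_bind, h, Timed.val_op, Timed.val_pure]

lemma steps_roundStep_le (ω : RoundTape n m (sketchDim n ε) E.Seed)
    (st : Finset (Fin n) × (Fin n → ℝ)) :
    (roundStep E o tie edges δ ω st).steps ≤
      (estimateDelta E o edges δ (sketchDim n ε) st.2 ω).steps + (7 * n + 2) := by
  obtain ⟨T, s⟩ := st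
  simp only [roundStep, Timed.steps_bind]
  have h := steps_argmaxOutside_le tie T (estimateDelta E o edges δ (sketchDim n ε) s ω).val
  cases (argmaxOutside tie T (estimateDelta E o edges δ (sketchDim n ε) s ω).val).val with
  | none => simp only [Timed.steps_pure]; omega
  | some i => simp only [Timed.steps_bind, Timed.steps_op, Timed.steps_pure]; omega

lemma tapeLaw_eq (k : ℕ) : tapeLaw E κ n m (sketchDim n ε) k =
    Measure.pi fun _ : Fin k => roundLaw E κ n m (sketchDim n ε) := rfl

/-! ### Approximation guarantee -/

/-- A successful round decreases the gap to the optimum by the factor `1 - (1 - ε) / k`. -/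
lemma roundStep_spec (hn : 2 ≤ n) (hG : G.Connected) (hε : 0 < ε) (hε2 : ε ≤ 1 / 2)
    {s : Fin n → ℝ} (hs : ∀ i, 0 ≤ s i) {k : ℕ} (hk : 0 < k) {T Topt : Finset (Fin n)}
    (hT : T.card < n) (hcard : Topt.card = k) {ω : RoundTape n m (sketchDim n ε) E.Seed}
    (hω : RoundOK E edges δ (sketchDim_pos hn hε) (zeroOn s T) ω) :
    ∃ i, i ∉ T ∧ (roundStep E o tie edges δ ω (T, zeroOn s T)).val =
        (insert i T, zeroOn s (insert i T)) ∧
      objective G o s (insert i T) - objective G o s Topt ≤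
        (1 - (1 - ε) / k) * (objective G o s T - objective G o s Topt) := by
  obtain ⟨i, hi, hiT, hmax⟩ := argmaxOutside_spec tie T
    (estimateDelta E o edges δ (sketchDim n ε) (zeroOn s T) ω).val hT
  refine ⟨i, hiT, ?_, ?_⟩
  · rw [val_roundStep E o tie edges δ ω T _ hi, update_zeroOn]
  · simp only [objective_eq_quad]
    refine greedy_progress (conflictMatrix_symm G o) (conflictMatrix_nonneg G o) hs hk hcard
      (by linarith) fun j hj => ?_
    have hd := hmax j hj
    have e := abs_estimateDelta_sub_gain_le E o edges δ (sketchDim_pos hn hε) hn hG hε hε2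
      (zeroOn_nonneg hs T) hω
    have e1 := (abs_le.mp (e i)).2
    have e2 := (abs_le.mp (e j)).1
    have g2 := gain_nonneg (conflictMatrix_nonneg G o) (zeroOn_nonneg hs T) j
    set a := gain (conflictMatrix G o) (zeroOn s T) i
    set b := gain (conflictMatrix G o) (zeroOn s T) j
    have h1 : (1 - ε / 2) * b ≤ (1 + ε / 2) * a := by linarith
    -- `(1 - ε/2) / (1 + ε/2) ≥ 1 - ε`.
    have h2 : (1 + ε / 2) * ((1 - ε) * b) ≤ (1 - ε / 2) * b := by
      nlinarith [mul_nonneg (sq_nonneg ε) g2]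
    exact le_of_mul_le_mul_left (h2.trans h1) (by linarith)

lemma approximation (hn : 2 ≤ n) {k : ℕ} (hkn : k ≤ n) (hG : G.Connected) (hε : 0 < ε)
    (hε2 : ε ≤ 1 / 2) {s : Fin n → ℝ} (hs : ∀ i, 0 ≤ s i) {η : ℕ → ℝ} (hE : E.Reliable η)
    (hη : η n ≤ 1) {Topt : Finset (Fin n)} (hopt : IsOptimal (objective G o s) k Topt) :
    (1 - 1 / (n : ℝ)) * (1 - η n) ^ ((2 * sketchDim n ε + 2) * k) ≤
      (tapeLaw E κ n m (sketchDim n ε) k).real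
        {τ | (greedyAC E o tie edges δ s k τ).val.card = k ∧
          (1 - 1 / Real.exp 1 - ε) * (objective G o s ∅ - objective G o s Topt) ≤
            objective G o s ∅ - objective G o s (greedyAC E o tie edges δ s k τ).val} := by
  have hn2 : (2 : ℝ) ≤ n := by exact_mod_cast hn
  set f := objective G o s with hf
  set D := f ∅ - f Topt with hD
  have hD0 : 0 ≤ D := by
    have h := (quad_zeroOn_union (conflictMatrix_symm G o) (conflictMatrix_nonneg G o) hs
      ∅ Topt).1
    rw [Finset.empty_union, ← objective_eq_quad, ← objective_eq_quad] at h
    linarith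
  -- The invariant ties the working copy of `s` to `T`, so a round's estimated gains are those of
  -- `f` at `T`.
  let R : ℕ → Finset (Fin n) × (Fin n → ℝ) → Prop := fun j st =>
    st.1.card = j ∧ st.2 = zeroOn s st.1 ∧ f st.1 - f Topt ≤ (1 - (1 - ε) / k) ^ j * D
  have hloop := pow_le_measure_loop (μ := roundLaw E κ n m (sketchDim n ε))
    (roundStep E o tie edges δ)
    (fun st => {ω | RoundOK E edges δ (sketchDim_pos hn hε) st.2 ω})
    (fun st => measurableSet_roundOK E edges δ (sketchDim_pos hn hε) st.2)
    (ENNReal.ofReal (1 - 1 / (n : ℝ) ^ 2) *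
      ENNReal.ofReal (1 - η n) ^ (2 * sketchDim n ε + 2)) k R
    (fun j st _ _ => le_measure_roundOK edges δ st.2 κ hn hε hε2 hE)
    (by
      rintro j ⟨T, s'⟩ ω hj ⟨hc, hs', hprog⟩ hω
      simp only at hc hs' hprog
      subst hs'
      obtain ⟨i, hiT, hv, hstep⟩ := roundStep_spec E o tie edges δ hn hG hε hε2 hs
        (Nat.zero_lt_of_lt hj) (by omega) hopt.1 hω
      rw [hv]
      refine ⟨?_, rfl, ?_⟩
      · rw [Finset.card_insert_of_notMem hiT, hc]
      · refine hstep.trans ?_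
        have hk1 : (1 : ℝ) ≤ k := by exact_mod_cast Nat.zero_lt_of_lt hj
        have h2 : (1 - ε) / k ≤ 1 := by
          rw [div_le_one (by linarith)]; linarith
        rw [pow_succ', mul_assoc]
        exact mul_le_mul_of_nonneg_left hprog (by linarith))
    k 0 (by omega) (∅, s) ⟨rfl, (zeroOn_empty s).symm, by simp [hD]⟩
  have hsub : {τ : Fin k → RoundTape n m (sketchDim n ε) E.Seed |
      R k (Timed.loop k (fun t => roundStep E o tie edges δ (τ t)) (∅, s)).val} ⊆
      {τ | (greedyAC E o tie edges δ s k τ).val.card = k ∧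
          (1 - 1 / Real.exp 1 - ε) * D ≤ f ∅ - f (greedyAC E o tie edges δ s k τ).val} := by
    rintro τ ⟨hc, -, hprog⟩
    rw [← val_greedyAC] at hc hprog
    refine ⟨hc, ?_⟩
    -- For `k = 0` the contraction factor is meaningless, but both sets are empty and the gap
    -- vanishes.
    rcases Nat.eq_zero_or_pos k with hk | hk
    · have hT : Topt = ∅ := Finset.card_eq_zero.mp (hopt.1.trans hk)
      have hV : (greedyAC E o tie edges δ s k τ).val = ∅ := Finset.card_eq_zero.mp (hc.trans hk)
      have : D = 0 := by rw [hD, hT, sub_self]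
      rw [this, hV]
      simp
    · have h1 := mul_le_mul_of_nonneg_right (greedy_factor_le hk hε.le hε2) hD0
      have h2 : f (greedyAC E o tie edges δ s k τ).val - f Topt ≤ (1 / Real.exp 1 + ε) * D :=
        hprog.trans h1
      have h3 : f ∅ - f Topt = D := rfl
      linarith
  -- Bernoulli's inequality together with `k ≤ n`.
  have hpow : 1 - 1 / (n : ℝ) ≤ (1 - 1 / (n : ℝ) ^ 2) ^ k := by
    have h1 : (1 : ℝ) / (n : ℝ) ^ 2 ≤ 1 := by
      rw [div_le_one (by positivity)]; nlinarith
    have h2 := one_add_mul_le_pow (a := -(1 / (n : ℝ) ^ 2)) (by linarith) k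
    have h3 : (k : ℝ) * (1 / (n : ℝ) ^ 2) ≤ 1 / n := by
      have hk' : (k : ℝ) ≤ n := by exact_mod_cast hkn
      calc (k : ℝ) * (1 / (n : ℝ) ^ 2) ≤ n * (1 / (n : ℝ) ^ 2) :=
            mul_le_mul_of_nonneg_right hk' (by positivity)
        _ = 1 / n := by field_simp
    have h4 : (1 + -(1 / (n : ℝ) ^ 2)) ^ k = (1 - 1 / (n : ℝ) ^ 2) ^ k := by
      rw [← sub_eq_add_neg]
    rw [h4] at h2
    linarith
  have hfin := hloop.trans (measure_mono hsub)
  rw [tapeLaw_eq]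
  refine (ENNReal.ofReal_le_iff_le_toReal (measure_ne_top _ _)).mp (le_trans ?_ hfin)
  have h1 : (1 : ℝ) / (n : ℝ) ^ 2 ≤ 1 := by
    rw [div_le_one (by positivity)]; nlinarith
  rw [mul_pow, ← pow_mul, ← ENNReal.ofReal_pow (by linarith), ← ENNReal.ofReal_pow (by linarith),
    ← ENNReal.ofReal_mul (pow_nonneg (by linarith) _)]
  exact ENNReal.ofReal_le_ofReal
    (mul_le_mul_of_nonneg_right hpow (pow_nonneg (by linarith) _))

/-! ### Running time -/

section Time

variable {p : ℕ} (s : Fin n → ℝ)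

/-- The solver's expected cost is bounded for every right-hand side, so it may be bounded
conditionally on the projections. -/
lemma lintegral_roundLaw_le {f : RoundTape n m p E.Seed → ℝ≥0∞} {K : ℝ≥0∞}
    (h : ∀ P Q, ∫⁻ σ, f (P, Q, σ)
      ∂(Measure.pi fun _ : Fin p => Measure.pi fun _ : Fin 4 => E.seedLaw) ≤ K) :
    ∫⁻ τ, f τ ∂(roundLaw E κ n m p) ≤ K := by
  refine (lintegral_prod_le _).trans ?_
  have h1 : ∀ P, ∫⁻ z, f (P, z) ∂((Measure.pi fun _ : Fin p => Measure.pi fun _ : Fin m =>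
      κ.entryLaw p).prod (Measure.pi fun _ : Fin p => Measure.pi fun _ : Fin 4 => E.seedLaw)) ≤
      K := by
    intro P
    refine (lintegral_prod_le _).trans ((lintegral_mono fun Q => h P Q).trans ?_)
    rw [lintegral_const, measure_univ, mul_one]
  refine (lintegral_mono h1).trans ?_
  rw [lintegral_const, measure_univ, mul_one]

lemma measurable_natCast_ennreal : Measurable (fun k : ℕ => (k : ℝ≥0∞)) :=
  measurable_of_countable _

lemma measurable_run_steps (S : Matrix (Fin n) (Fin n) ℝ) (b : Fin n → ℝ) (d : ℝ) :
    Measurable fun ω => ((E.run S b d ω).steps : ℝ≥0∞) :=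
  measurable_natCast_ennreal.comp ((E.measurable_steps S d).comp measurable_prodMk_left)

lemma measurable_solve_steps (r : Fin p) :
    (Measurable fun τ : RoundTape n m p E.Seed => ((solveQ E δ s τ r).steps : ℝ≥0∞)) ∧
    (Measurable fun τ : RoundTape n m p E.Seed => ((solveH E δ s τ r).steps : ℝ≥0∞)) ∧
    (Measurable fun τ : RoundTape n m p E.Seed => ((solveX E edges δ τ r).steps : ℝ≥0∞)) ∧
    (Measurable fun τ : RoundTape n m p E.Seed => ((solveY E δ τ r).steps : ℝ≥0∞)) := by
  have hseed : ∀ (a : Fin 4), Measurable fun τ : RoundTape n m p E.Seed => τ.2.2 r a :=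
    fun a => by fun_prop
  have hq : Measurable fun τ : RoundTape n m p E.Seed => (solveQ E δ s τ r).val :=
    ((E.measurable_val (shiftedLap G) δ.δ₃).comp measurable_prodMk_left).comp (hseed 0)
  refine ⟨(measurable_run_steps E _ s δ.δ₃).comp (hseed 0), ?_, ?_, ?_⟩
  · exact measurable_natCast_ennreal.comp
      ((E.measurable_steps (shiftedLap G) δ.δ₃).comp (hq.prodMk (hseed 1)))
  · exact measurable_natCast_ennreal.comp ((E.measurable_steps (shiftedLap G) δ.δ₁).comp
      (((measurable_edgeDiv edges).comp (by fun_prop)).prodMk (hseed 2)))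
  · exact measurable_natCast_ennreal.comp ((E.measurable_steps (shiftedLap G) δ.δ₂).comp
      (Measurable.prodMk (by fun_prop) (hseed 3)))

lemma lintegral_seed_eval (r : Fin p) (a : Fin 4) {g : E.Seed → ℝ≥0∞} (hg : Measurable g) :
    ∫⁻ σ, g (σ r a) ∂(Measure.pi fun _ : Fin p => Measure.pi fun _ : Fin 4 => E.seedLaw) =
      ∫⁻ ω, g ω ∂E.seedLaw := by
  have h1 := (measurePreserving_eval
    (fun _ : Fin p => Measure.pi fun _ : Fin 4 => E.seedLaw) r).lintegral_comp
    (f := fun σ => g (σ a)) (hg.comp (measurable_pi_apply a))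
  have h2 := (measurePreserving_eval (fun _ : Fin 4 => E.seedLaw) a).lintegral_comp hg
  exact h1.trans h2

variable {E} in
lemma lintegral_solve_steps_le (hn : 2 ≤ n) {A : ℝ} {a : ℕ} (hE : E.NearlyLinear A a)
    (r : Fin p) :
    (∫⁻ τ, ((solveQ E δ s τ r).steps : ℝ≥0∞) ∂(roundLaw E κ n m p) ≤
      ENNReal.ofReal (A * nnz (shiftedLap G) * Real.log n ^ a)) ∧
    (∫⁻ τ, ((solveH E δ s τ r).steps : ℝ≥0∞) ∂(roundLaw E κ n m p) ≤
      ENNReal.ofReal (A * nnz (shiftedLap G) * Real.log n ^ a)) ∧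
    (∫⁻ τ, ((solveX E edges δ τ r).steps : ℝ≥0∞) ∂(roundLaw E κ n m p) ≤
      ENNReal.ofReal (A * nnz (shiftedLap G) * Real.log n ^ a)) ∧
    (∫⁻ τ, ((solveY E δ τ r).steps : ℝ≥0∞) ∂(roundLaw E κ n m p) ≤
      ENNReal.ofReal (A * nnz (shiftedLap G) * Real.log n ^ a)) := by
  have hS := isSDDM_shiftedLap G
  refine ⟨?_, ?_, ?_, ?_⟩ <;> refine lintegral_roundLaw_le E κ fun P Q => ?_
  · exact (lintegral_seed_eval E r 0 (measurable_run_steps E (shiftedLap G) s δ.δ₃)).trans_le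
      (hE n _ s _ hn hS δ.pos₃)
  · have h1 := (measurePreserving_eval
      (fun _ : Fin p => Measure.pi fun _ : Fin 4 => E.seedLaw) r).lintegral_comp
      (f := fun σ => ((E.run (shiftedLap G) (E.run (shiftedLap G) s δ.δ₃ (σ 0)).val δ.δ₃
        (σ 1)).steps : ℝ≥0∞))
      (measurable_natCast_ennreal.comp ((E.measurable_steps (shiftedLap G) δ.δ₃).comp
        ((((E.measurable_val (shiftedLap G) δ.δ₃).comp (measurable_prodMk_left (x := s))).comp
          (measurable_pi_apply 0)).prodMk (measurable_pi_apply 1))))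
    -- The right-hand side of this call depends on the first seed; fixing that seed leaves an
    -- ordinary call with a fresh one.
    refine h1.trans_le ((lintegral_pi_succ_le _).trans ?_)
    have h2 : ∀ x : E.Seed, ∫⁻ y : Fin 3 → E.Seed,
        ((E.run (shiftedLap G) (E.run (shiftedLap G) s δ.δ₃ x).val δ.δ₃ (y 0)).steps : ℝ≥0∞)
        ∂(Measure.pi fun _ : Fin 3 => E.seedLaw) ≤
        ENNReal.ofReal (A * nnz (shiftedLap G) * Real.log n ^ a) := fun x =>
      ((measurePreserving_eval (fun _ : Fin 3 => E.seedLaw) 0).lintegral_comp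
        (measurable_run_steps E (shiftedLap G) _ δ.δ₃)).trans_le (hE n _ _ _ hn hS δ.pos₃)
    refine (lintegral_mono h2).trans ?_
    rw [lintegral_const, measure_univ, mul_one]
  · exact (lintegral_seed_eval E r 2
      (measurable_run_steps E (shiftedLap G) (edgeDiv edges (Q r)) δ.δ₁)).trans_le (hE n _ _ _ hn hS δ.pos₁)
  · exact (lintegral_seed_eval E r 3
      (measurable_run_steps E (shiftedLap G) (P r) δ.δ₂)).trans_le (hE n _ _ _ hn hS δ.pos₂)

variable {E} in
lemma lintegral_estimateDelta_steps_le (hn : 2 ≤ n) {A : ℝ} {a : ℕ} (hE : E.NearlyLinear A a) :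
    ∫⁻ τ, ((estimateDelta E o edges δ p s τ).steps : ℝ≥0∞) ∂(roundLaw E κ n m p) ≤
      ((4 + (n + 13 * m) + p * (2 * n + 1) + p * (2 * m + 1) + p * (2 * n + 8 * m + 1) +
        p * (1 + 8 * n) + n * (8 * p + 17) : ℕ) : ℝ≥0∞) +
      p * (4 * ENNReal.ofReal (A * nnz (shiftedLap G) * Real.log n ^ a)) := by
  simp only [steps_estimateDelta]
  set c := 4 + (n + 13 * m) + p * (2 * n + 1) + p * (2 * m + 1) + p * (2 * n + 8 * m + 1) +
        p * (1 + 8 * n) + n * (8 * p + 17)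
  have hm := fun r => measurable_solve_steps (p := p) E edges δ s r
  have hi := fun r => lintegral_solve_steps_le (p := p) κ edges δ s hn hE r
  simp only [Nat.cast_add c, Nat.cast_sum, Nat.cast_add]
  rw [lintegral_add_left measurable_const, lintegral_const, measure_univ, mul_one]
  refine add_le_add_right ?_ _
  have hsum : ∀ r : Fin p, Measurable fun τ : RoundTape n m p E.Seed =>
      ((solveQ E δ s τ r).steps + (solveH E δ s τ r).steps +
        (solveX E edges δ τ r).steps + (solveY E δ τ r).steps : ℝ≥0∞) := fun r =>
    (((hm r).1.add (hm r).2.1).add (hm r).2.2.1).add (hm r).2.2.2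
  rw [lintegral_finsetSum _ fun r _ => hsum r]
  calc ∑ r, ∫⁻ τ, ((solveQ E δ s τ r).steps + (solveH E δ s τ r).steps +
        (solveX E edges δ τ r).steps + (solveY E δ τ r).steps : ℝ≥0∞) ∂(roundLaw E κ n m p)
      ≤ ∑ _r : Fin p, 4 * ENNReal.ofReal (A * nnz (shiftedLap G) * Real.log n ^ a) := by
        refine Finset.sum_le_sum fun r _ => ?_
        rw [lintegral_add_right _ (hm r).2.2.2, lintegral_add_right _ (hm r).2.2.1,
          lintegral_add_right _ (hm r).2.1]
        refine (add_le_add (add_le_add (add_le_add (hi r).1 (hi r).2.1) (hi r).2.2.1)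
          (hi r).2.2.2).trans (le_of_eq ?_)
        ring
    _ = _ := by rw [Finset.sum_const, Finset.card_univ, Fintype.card_fin, nsmul_eq_mul]

end Time

lemma half_le_log (hn : 2 ≤ n) : 1 / 2 ≤ Real.log n := by
  have h1 : Real.log 2 ≤ Real.log n :=
    Real.log_le_log two_pos (by exact_mod_cast hn)
  linarith [Real.log_two_gt_d9]

/-- `3456 = 24 · 12²`, and rounding up costs at most `1 ≤ log n · ε⁻²`. -/
lemma sketchDim_le (hn : 2 ≤ n) (hε : 0 < ε) (hε2 : ε ≤ 1 / 2) :
    (sketchDim n ε : ℝ) ≤ 3457 * (Real.log n * ε⁻¹ ^ 2) := by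
  have hl := half_le_log hn
  have h1 : (sketchDim n ε : ℝ) ≤ 24 * Real.log n / (ε / 12) ^ 2 + 1 :=
    (Nat.ceil_lt_add_one (by positivity)).le
  have h2 : 24 * Real.log n / (ε / 12) ^ 2 = 3456 * (Real.log n * ε⁻¹ ^ 2) := by
    field_simp
    norm_num
  have h3 : 2 ≤ ε⁻¹ := by
    rw [le_inv_comm₀ two_pos hε]; linarith
  have h4 : 1 ≤ Real.log n * ε⁻¹ ^ 2 := by nlinarith
  linarith

lemma running_time (hn : 2 ≤ n) {k : ℕ} (hk : 1 ≤ k) (hG : G.Connected) (hε : 0 < ε)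
    (hε2 : ε ≤ 1 / 2) (s : Fin n → ℝ) {A : ℝ} {a : ℕ} (hE : E.NearlyLinear A a) :
    ∫⁻ τ, ((greedyAC E o tie edges δ s k τ).steps : ℝ≥0∞)
        ∂(tapeLaw E κ n m (sketchDim n ε) k) ≤
      ENNReal.ofReal (3457 * (128 * 2 ^ a + 16 * |A|) * (m * k * (ε⁻¹) ^ 2) *
        Real.log n ^ (a + 1)) := by
  set p := sketchDim n ε with hp
  have hp1 : 1 ≤ p := sketchDim_pos hn hε
  have hl := half_le_log hn
  have hnm := le_edges_add_one hG edges
  have hm1 : 1 ≤ m := by omega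
  have hn2m : n ≤ 2 * m := by omega
  have hnnz : nnz (shiftedLap G) ≤ 4 * m := (nnz_shiftedLap_le edges).trans (by omega)
  -- The absolute value keeps the bound nonnegative whatever the sign of `A`.
  set K : ℝ := |A| * (4 * m) * Real.log n ^ a with hK
  have hK0 : 0 ≤ K := by positivity
  have hKle : A * nnz (shiftedLap G) * Real.log n ^ a ≤ K := by
    refine mul_le_mul_of_nonneg_right ?_ (by positivity)
    refine (mul_le_mul_of_nonneg_right (le_abs_self A) (Nat.cast_nonneg _)).trans ?_
    refine mul_le_mul_of_nonneg_left ?_ (abs_nonneg A)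
    exact_mod_cast hnnz
  set c : ℕ := 4 + (n + 13 * m) + p * (2 * n + 1) + p * (2 * m + 1) + p * (2 * n + 8 * m + 1) +
        p * (1 + 8 * n) + n * (8 * p + 17) with hc
  have hround : ∀ st, ∫⁻ ω, ((roundStep E o tie edges δ ω st).steps : ℝ≥0∞)
      ∂(roundLaw E κ n m p) ≤ ((c + (7 * n + 2) : ℕ) : ℝ≥0∞) + p * (4 * ENNReal.ofReal K) := by
    intro st
    calc ∫⁻ ω, ((roundStep E o tie edges δ ω st).steps : ℝ≥0∞) ∂(roundLaw E κ n m p)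
        ≤ ∫⁻ ω, (((7 * n + 2 : ℕ) : ℝ≥0∞) +
            ((estimateDelta E o edges δ p st.2 ω).steps : ℝ≥0∞)) ∂(roundLaw E κ n m p) := by
          refine lintegral_mono fun ω => ?_
          rw [← Nat.cast_add, add_comm]
          exact Nat.cast_le.mpr (steps_roundStep_le E o tie edges δ ω st)
      _ = ((7 * n + 2 : ℕ) : ℝ≥0∞) +
            ∫⁻ ω, ((estimateDelta E o edges δ p st.2 ω).steps : ℝ≥0∞) ∂(roundLaw E κ n m p) := by
          rw [lintegral_add_left measurable_const, lintegral_const, measure_univ, mul_one]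
      _ ≤ ((7 * n + 2 : ℕ) : ℝ≥0∞) + ((c : ℝ≥0∞) + p * (4 * ENNReal.ofReal K)) := by
          refine add_le_add_right ((lintegral_estimateDelta_steps_le κ o edges δ st.2 hn
            hE).trans ?_) _
          gcongr
      _ = _ := by push_cast; ring
  have htotal : ∫⁻ τ, ((greedyAC E o tie edges δ s k τ).steps : ℝ≥0∞)
        ∂(tapeLaw E κ n m p k) ≤ ((2 * n : ℕ) : ℝ≥0∞) +
        k * (1 + (((c + (7 * n + 2) : ℕ) : ℝ≥0∞) + p * (4 * ENNReal.ofReal K))) := by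
    simp only [steps_greedyAC, Nat.cast_add (2 * n)]
    rw [lintegral_add_left measurable_const, lintegral_const, tapeLaw_eq, measure_univ, mul_one]
    exact add_le_add_right (lintegral_steps_loop_le _ _ hround k (∅, s)) _
  refine htotal.trans ?_
  clear_value K c
  have hof : ((2 * n : ℕ) : ℝ≥0∞) +
      k * (1 + (((c + (7 * n + 2) : ℕ) : ℝ≥0∞) + p * (4 * ENNReal.ofReal K))) =
      ENNReal.ofReal (((2 * n : ℕ) : ℝ) +
        k * (1 + (((c + (7 * n + 2) : ℕ) : ℝ) + p * (4 * K)))) := by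
    rw [ENNReal.ofReal_add (by positivity) (by positivity), ENNReal.ofReal_mul (by positivity),
      ENNReal.ofReal_add (by positivity) (by positivity), ENNReal.ofReal_one,
      ENNReal.ofReal_add (by positivity) (by positivity), ENNReal.ofReal_mul (by positivity),
      ENNReal.ofReal_mul (by positivity), ENNReal.ofReal_natCast, ENNReal.ofReal_natCast,
      ENNReal.ofReal_natCast, ENNReal.ofReal_natCast, ENNReal.ofReal_ofNat]
  rw [hof]
  refine ENNReal.ofReal_le_ofReal ?_
  have hdet : 1 + (c + (7 * n + 2)) ≤ 124 * (p * m) := by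
    have h1 : m ≤ p * m := Nat.le_mul_of_pos_left m hp1
    have h2 : p ≤ p * m := Nat.le_mul_of_pos_right p hm1
    have h3 : p * n ≤ 2 * (p * m) := by nlinarith
    rw [hc]
    nlinarith
  have hnk : 2 * n ≤ 4 * (k * (p * m)) := by
    have h1 : m ≤ p * m := Nat.le_mul_of_pos_left m hp1
    have h2 : p * m ≤ k * (p * m) := Nat.le_mul_of_pos_left _ hk
    omega
  have hdet' : 1 + ((c + (7 * n + 2) : ℕ) : ℝ) ≤ 124 * (p * m) := by exact_mod_cast hdet
  have hnk' : ((2 * n : ℕ) : ℝ) ≤ 4 * (k * (p * m)) := by exact_mod_cast hnk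
  have hkpos : (0 : ℝ) ≤ k := Nat.cast_nonneg k
  have hmpos : (0 : ℝ) ≤ m := Nat.cast_nonneg m
  -- As `log n ≥ 1/2`, the deterministic cost is absorbed into the same power of `log n` as the
  -- solver cost; hence `2 ^ a` in the constant.
  have hloga : 1 ≤ 2 ^ a * Real.log n ^ a := by
    rw [← mul_pow]
    exact one_le_pow₀ (by linarith)
  have hplog := sketchDim_le (n := n) hn hε hε2
  rw [← hp] at hplog
  calc ((2 * n : ℕ) : ℝ) + k * (1 + (((c + (7 * n + 2) : ℕ) : ℝ) + p * (4 * K)))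
      ≤ 4 * (k * (p * m)) + k * (124 * (p * m) + p * (4 * K)) := by
        refine add_le_add hnk' (mul_le_mul_of_nonneg_left (by linarith) hkpos)
    _ = k * m * p * (128 * 1 + 16 * |A| * Real.log n ^ a) := by rw [hK]; ring
    _ ≤ k * m * p * (128 * (2 ^ a * Real.log n ^ a) + 16 * |A| * Real.log n ^ a) := by
        refine mul_le_mul_of_nonneg_left (by linarith) (by positivity)
    _ ≤ k * m * (3457 * (Real.log n * ε⁻¹ ^ 2)) *
        (128 * (2 ^ a * Real.log n ^ a) + 16 * |A| * Real.log n ^ a) := by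
        refine mul_le_mul_of_nonneg_right (mul_le_mul_of_nonneg_left hplog (by positivity))
          (by positivity)
    _ = _ := by ring

end Main

end GreedyAC

end

open GreedyAC in
theorem mainTheorem1 (A : ℝ) (a : ℕ) :
    ∃ (C : ℝ) (c : ℕ),
      ∀ (E : Estimator) (κ : Sketch) (o : Objective)
        (n m k : ℕ) (_ : 2 ≤ n) (_ : k ≤ n)
        (G : SimpleGraph (Fin n)) [DecidableRel G.Adj] (_ : G.Connected) (edges : EdgeList G m)
        (s : Fin n → ℝ) (_ : ∀ i, s i ∈ Set.Icc (0 : ℝ) 1)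
        (ε : ℝ) (_ : 0 < ε) (_ : ε ≤ 1 / 2) (δ : Precision G ε)
        (tie : Finset (Fin n) → Fin n → Fin n → Bool),
        (∀ η : ℕ → ℝ, E.Reliable η → η n ≤ 1 →
          ∀ Topt : Finset (Fin n), IsOptimal (objective G o s) k Topt →
            (1 - 1 / (n : ℝ)) * (1 - η n) ^ ((2 * sketchDim n ε + 2) * k) ≤
              (tapeLaw E κ n m (sketchDim n ε) k).real
                {τ | (greedyAC E o tie edges δ s k τ).val.card = k ∧
                  (1 - 1 / Real.exp 1 - ε) * (objective G o s ∅ - objective G o s Topt) ≤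
                    objective G o s ∅ -
                      objective G o s (greedyAC E o tie edges δ s k τ).val}) ∧
        (E.NearlyLinear A a → 1 ≤ k →
          ∫⁻ τ, ((greedyAC E o tie edges δ s k τ).steps : ℝ≥0∞)
              ∂(tapeLaw E κ n m (sketchDim n ε) k) ≤
            ENNReal.ofReal (C * (m * k * (ε⁻¹) ^ 2) * Real.log n ^ c)) := by
  refine ⟨3457 * (128 * 2 ^ a + 16 * |A|), a + 1, ?_⟩
  intro E κ o n m k hn hkn G _ hG edges s hs ε hε hε2 δ tie
  exact ⟨fun η hE hη Topt hopt =>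
      approximation E κ o tie edges δ hn hkn hG hε hε2 (fun i => (hs i).1) hE hη hopt,
    fun hE hk => running_time E κ o tie edges δ hn hk hG hε hε2 s hE⟩
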